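/- Let $p\ge 0$, and let $\sigma_0\le\sigma_1\le\dots\le\sigma_{n+p}$ be an open knot vector (the first $p+1$ knots coincide, the last $p+1$ knots coincide, and no knot is repeated more than $p+1$ times). Let $N_0,\dots,N_{n-1}$ be the B-spline basis functions of degree $p$ given by the Cox–de Boor recursion, let $\mathcal T$ be their span, and suppose that the functions in $\mathcal T$ are $C^\alpha$-continuous on $(\sigma_0,\sigma_{n+p})$, where $\alpha\ge -1$ is an integer ($\alpha=-1$ meaning no condition). The Bézier elements $e$ are the nonempty knot spans $\Omega^e=(\sigma_e,\sigma_{e+1})$, with mesh size $h_e=\sigma_{e+1}-\sigma_e$. The mesh is shape regular with constant $\theta$ if $h_e\le\theta h_{e'}$ for all pairs of neighbouring elements $e,e'$. The support extension $\widetilde\Omega^e$ is the interior of the union of the supports of those basis functions whose support intersects $\Omega^e$, and $\mathsf E_A$ is the set of elements in the support of $N_A$. The Bézier projection is $$\Pi_B f=\sum_{A}\Big[\sum_{e\in\mathsf E_A}\omega_A^e\,\lambda_A^e(f)\Big]N_A,\qquad \omega_A^e=\frac{\int_{\Omega^e}N_A}{\sum_{e'\in\mathsf E_A}\int_{\Omega^{e'}}N_A},$$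 where $\lambda^e(f)=(\mathbf C^e)^{-\mathrm T}\beta^e(f)$. Here $\beta^e(f)$ is the vector of Bernstein coefficients of the $L^2(-1,1)$-projection of $f\circ\phi_e$ onto the polynomials of degree at most $p$, $\phi_e:[-1,1]\to\overline{\Omega^e}$ is the increasing affine bijection, and $\mathbf C^e$ is the $(p+1)\times(p+1)$ element extraction matrix whose rows are $\beta^e(N_A)$ for the $p+1$ basis functions $N_A$ that do not vanish on $\Omega^e$. (On $\Omega^e$ the function $\Pi_Bf$ depends only on $f|_{\widetilde\Omega^e}$.) **Theorem.** Let $k,l$ be integers with $0\le k\le l\le p+1$ and $l\le\alpha+1$. For every $\theta$ there is a constant $C>0$, depending only on $\theta$, $p$, $\alpha$, $k$ and $l$, such that for every such spline space on a mesh that is shape regular with constant $\theta$, every Bézier element $e$ and every $f\in H^l(\widetilde\Omega^e)$ one has $f-\Pi_Bf\in H^k(\Omega^e)$ and $$\|f-\Pi_B f\|_{H^k(\Omega^e)}\le C\,h_e^{\,l-k}\,\|f\|_{H^l(\widetilde\Omega^e)},$$ where $\|g\|_{H^m(U)}^2=\sum_{j=0}^m\|g^{(j)}\|_{L^2(U)}^2$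 with weak derivatives. -/

import Mathlib

open MeasureTheory
open scoped ContDiff

namespace BezierProjection

noncomputable section

/-! ### Sobolev spaces on an open subset of the real line -/

/-- `g` is the weak derivative of order `j` of `f` on the open set `U`. -/
def HasWeakDeriv (j : ℕ) (f g : ℝ → ℝ) (U : Set ℝ) : Prop :=
  LocallyIntegrableOn f U ∧ LocallyIntegrableOn g U ∧
    ∀ φ : ℝ → ℝ, ContDiff ℝ ∞ φ → HasCompactSupport φ → tsupport φ ⊆ U →
      ∫ x in U, f x * iteratedDeriv j φ x = (-1) ^ j * ∫ x in U, g x * φ x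

/-- `f` belongs to the Sobolev space `H^k(U)`: it has weak derivatives of all orders `j ≤ k`
on `U`, and these are square integrable on `U`. -/
def MemH (k : ℕ) (f : ℝ → ℝ) (U : Set ℝ) : Prop :=
  ∀ j ≤ k, ∃ g : ℝ → ℝ, HasWeakDeriv j f g U ∧ MemLp g 2 (volume.restrict U)

open scoped Classical in
/-- A representative of the weak derivative of order `j` of `f` on `U`, which is unique up to
equality almost everywhere on `U`; zero if there is none. -/
def weakDeriv (j : ℕ) (f : ℝ → ℝ) (U : Set ℝ) : ℝ → ℝ :=
  if h : ∃ g : ℝ → ℝ, HasWeakDeriv j f g U then h.choose else 0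

/-- The full norm of `H^k(U)`; it is meaningful for `f` with `MemH k f U`. -/
def normH (k : ℕ) (f : ℝ → ℝ) (U : Set ℝ) : ℝ :=
  Real.sqrt (∑ j ∈ Finset.range (k + 1), ∫ x in U, weakDeriv j f U x ^ 2)

/-! ### Bernstein polynomials on `[-1, 1]` -/

/-- The Bernstein basis polynomial of degree `p` with index `i` (counted from `0`). -/
def bernsteinB (p : ℕ) (i : Fin (p + 1)) (ξ : ℝ) : ℝ :=
  1 / 2 ^ p * (p.choose i : ℝ) * (1 - ξ) ^ (p - (i : ℕ)) * (1 + ξ) ^ (i : ℕ)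

/-- The Gramian matrix of the Bernstein basis. -/
def gramian (p : ℕ) : Matrix (Fin (p + 1)) (Fin (p + 1)) ℝ :=
  Matrix.of fun i j => ∫ ξ in (-1 : ℝ)..1, bernsteinB p i ξ * bernsteinB p j ξ

/-! ### Univariate B-splines -/

/-- The B-spline basis functions given by the Cox-de Boor recursion (a quotient with
denominator `0` is read as `0`). The index `A` is counted from `0`. -/
def coxDeBoor (σ : ℕ → ℝ) : ℕ → ℕ → ℝ → ℝ
  | 0, A, s => Set.indicator (Set.Ico (σ A) (σ (A + 1))) (fun _ => 1) s
  | q + 1, A, s =>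
      (s - σ A) / (σ (A + (q + 1)) - σ A) * coxDeBoor σ q A s +
        (σ (A + (q + 1) + 1) - s) / (σ (A + (q + 1) + 1) - σ (A + 1)) * coxDeBoor σ q (A + 1) s

/-- An open knot vector `σ 0 ≤ σ 1 ≤ ⋯ ≤ σ (n + p)` for `n` B-spline basis functions of
degree `p`. The values `σ i` with `i > n + p` play no role. -/
structure KnotVector (p n : ℕ) where
  σ : ℕ → ℝ
  mono : ∀ i < n + p, σ i ≤ σ (i + 1)
  open_left : σ 0 = σ p
  open_right : σ n = σ (n + p)
  /-- No knot is repeated more than `p + 1` times, that is, every basis function has a support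
  of positive length. -/
  nondegenerate : ∀ A < n, σ A < σ (A + p + 1)

namespace KnotVector

variable {p n : ℕ} (K : KnotVector p n)

/-- The basis function `N_A`, for `A < n`. -/
def N (A : ℕ) : ℝ → ℝ := coxDeBoor K.σ p A

/-- The spline space spanned by the basis functions. -/
def splineSpace : Submodule ℝ (ℝ → ℝ) :=
  Submodule.span ℝ (K.N '' Set.Iio n)

/-- The spline space consists of functions that are `C^α` on the domain (no condition on
continuity if `α = -1`). -/
def IsContinuity (α : ℤ) : Prop :=
  ∀ T ∈ K.splineSpace, ∀ m : ℕ, (m : ℤ) ≤ α →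
    ContDiffOn ℝ m T (Set.Ioo (K.σ 0) (K.σ (n + p)))

open scoped Classical in
/-- The Bézier elements, that is, the nonempty knot spans; the element `(σ e, σ (e + 1))` is
represented by the index `e`. -/
def elements : Finset ℕ :=
  (Finset.range (n + p)).filter fun e => K.σ e < K.σ (e + 1)

/-- The (open) domain `Ω^e` of an element. -/
def elemDomain (e : ℕ) : Set ℝ := Set.Ioo (K.σ e) (K.σ (e + 1))

/-- The mesh size `h_e` of an element. -/
def meshSize (e : ℕ) : ℝ := K.σ (e + 1) - K.σ e

/-- Shape regularity of the mesh with constant `θ`: the sizes of neighbouring elements differ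
at most by the factor `θ`. -/
def ShapeRegular (θ : ℝ) : Prop :=
  ∀ e ∈ K.elements, ∀ e' ∈ K.elements, K.σ (e + 1) = K.σ e' →
    K.meshSize e ≤ θ * K.meshSize e' ∧ K.meshSize e' ≤ θ * K.meshSize e

/-- The support of `N_A` intersects the element `e`. -/
def Overlaps (A e : ℕ) : Prop := (tsupport (K.N A) ∩ K.elemDomain e).Nonempty

open scoped Classical in
/-- The set `E_A` of the elements in the support of the basis function `N_A`. -/
def supportElements (A : ℕ) : Finset ℕ :=
  K.elements.filter fun e => K.Overlaps A e

/-- The support extension of the element `e`, the union of the supports of the basis functions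
whose support intersects `Ω^e`. We pass to the interior to obtain an open set, on which Sobolev
spaces are considered. -/
def supportExtension (e : ℕ) : Set ℝ :=
  interior (⋃ A ∈ {A : ℕ | A < n ∧ K.Overlaps A e}, tsupport (K.N A))

/-- The affine map from the biunit interval onto the element `e`. -/
def elemMap (e : ℕ) (ξ : ℝ) : ℝ := (K.σ e + K.σ (e + 1)) / 2 + K.meshSize e / 2 * ξ

/-- The Bernstein coefficients `β^e(f)` of the `L²` projection of `f ∘ φ_e` onto the polynomials
of degree at most `p`. -/
def bernsteinCoeff (e : ℕ) (f : ℝ → ℝ) : Fin (p + 1) → ℝ :=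
  (gramian p)⁻¹.mulVec fun i => ∫ ξ in (-1 : ℝ)..1, bernsteinB p i ξ * f (K.elemMap e ξ)

/-- The index of the local basis function number `a` on the element `e`: the basis functions
that do not vanish on `(σ e, σ (e + 1))` are `N_{e-p}, …, N_e`. (For an element `e` of an open
knot vector one has `p ≤ e < n`.) -/
def globalIndex (_K : KnotVector p n) (e : ℕ) (a : Fin (p + 1)) : ℕ := e - p + a

/-- The element extraction operator `C^e`: its rows hold the Bernstein coefficients of the
basis functions that do not vanish on the element `e`. -/
def extraction (e : ℕ) : Matrix (Fin (p + 1)) (Fin (p + 1)) ℝ :=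
  Matrix.of fun a i => K.bernsteinCoeff e (K.N (K.globalIndex e a)) i

/-- The element reconstruction operator `R^e`. -/
def reconstruction (e : ℕ) : Matrix (Fin (p + 1)) (Fin (p + 1)) ℝ := (K.extraction e)⁻¹

/-- The local spline coefficients `λ^e(f)` in the local numbering. -/
def localCoeff (e : ℕ) (f : ℝ → ℝ) : Fin (p + 1) → ℝ :=
  (K.reconstruction e).transpose.mulVec (K.bernsteinCoeff e f)

/-- The local coefficient `λ_A^e(f)` in the global numbering. -/
def coeffOnElement (e A : ℕ) (f : ℝ → ℝ) : ℝ :=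
  ∑ a : Fin (p + 1), if K.globalIndex e a = A then K.localCoeff e f a else 0

/-- The integral-based weight `ω_A^e`. -/
def weight (A e : ℕ) : ℝ :=
  (∫ s in K.elemDomain e, K.N A s) /
    ∑ e' ∈ K.supportElements A, ∫ s in K.elemDomain e', K.N A s

/-- The Bézier projection `Π_B f`. -/
def bezierProj (f : ℝ → ℝ) (s : ℝ) : ℝ :=
  ∑ A ∈ Finset.range n,
    (∑ e ∈ K.supportElements A, K.weight A e * K.coeffOnElement e A f) * K.N A s

end KnotVector

end

end BezierProjection

/-!
The error estimate rests on the reproduction of polynomials of degree at most `p` by the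
projection and on the stability of the local coefficients.

*Reproduction.* Marsden's identity (`marsden`) expands `(y - x) ^ p` in the B-splines on a knot
span, with the coefficient `∏ i, (y - σ (A + i))` for `N_A`. Comparing powers of `y` expands each
polynomial of degree at most `p`, the coefficient of `N_A` being its polar form at
`σ (A + 1), …, σ (A + p)` (`eval_eq_sum_polarForm`). This coefficient does not depend on the
element, so the weighted average over the elements in the support of `N_A` does not change it,
and the projection reproduces polynomials (`projCoeff_polynomial_add`).

*Stability.* Applied to the Bernstein polynomials in the coordinate of an element, the same
expansion exhibits the inverse of the extraction operator: its entries are polar forms of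
Bernstein polynomials at the rescaled knots (`bernsteinToSpline_mul_extraction`). Shape regularity
bounds these knots, hence the entries, uniformly in the mesh, and no compactness argument in the
knot vector is needed (`exists_abs_localCoeff_le`).

*Approximation.* The support extension is an open interval. By a du Bois-Reymond lemma of higher
order, a function on it with a weak derivative `g` of order `m` in `L²` is a polynomial of degree
less than `m` plus the `m`-fold primitive `F` of `g`
(`HasWeakDeriv.exists_polynomial_add_iterPrimitive`), and the derivatives of `F` are lower
primitives of `g`, bounded by powers of the length of the interval. The error of the projection
of `f` is that of `F`, and stability with an inverse inequality bounds its `j`-th derivative by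
`h ^ (m - j)` times the norm of `g` (`exists_hasWeakDeriv_sub_bezierProj`). In the theorem the
choice `m = l - k + j` yields the factor `h ^ (l - k)` for every `j ≤ k`, whether `h` is small
or large.
-/

namespace BezierProjection

/-! ### Weak derivatives on open sets -/

/-- `φ` is a test function on `U`: smooth, with compact support contained in `U`. -/
structure IsTestFun (φ : ℝ → ℝ) (U : Set ℝ) : Prop where
  contDiff : ContDiff ℝ ∞ φ
  hasCompactSupport : HasCompactSupport φ
  tsupport_subset : tsupport φ ⊆ U

namespace IsTestFun

variable {φ ψ : ℝ → ℝ} {U V : Set ℝ}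

lemma mono (h : IsTestFun φ V) (hVU : V ⊆ U) : IsTestFun φ U :=
  ⟨h.1, h.2, h.3.trans hVU⟩

lemma deriv (h : IsTestFun φ U) : IsTestFun (deriv φ) U :=
  ⟨(contDiff_infty_iff_deriv.1 h.1).2, h.2.deriv, (tsupport_deriv_subset (𝕜 := ℝ)).trans h.3⟩

lemma iteratedDeriv (h : IsTestFun φ U) (j : ℕ) : IsTestFun (iteratedDeriv j φ) U := by
  induction j with
  | zero => simpa using h
  | succ j ih => rw [iteratedDeriv_succ]; exact ih.deriv

lemma const_mul (h : IsTestFun φ U) (c : ℝ) : IsTestFun (fun x => c * φ x) U :=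
  ⟨contDiff_const.mul h.1, h.2.mul_left, (tsupport_mul_subset_right).trans h.3⟩

lemma sub (h : IsTestFun φ U) (h' : IsTestFun ψ U) : IsTestFun (fun x => φ x - ψ x) U :=
  ⟨h.1.sub h'.1, h.2.sub h'.2, (tsupport_sub φ ψ).trans (Set.union_subset h.3 h'.3)⟩

lemma eq_zero_of_notMem (h : IsTestFun φ U) {x : ℝ} (hx : x ∉ U) : φ x = 0 :=
  image_eq_zero_of_notMem_tsupport fun h' => hx (h.3 h')

lemma setIntegral_eq (h : IsTestFun φ U) (f : ℝ → ℝ) :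
    ∫ x in U, f x * φ x = ∫ x, f x * φ x :=
  setIntegral_eq_integral_of_forall_compl_eq_zero fun x hx => by
    simp [h.eq_zero_of_notMem hx]

lemma integrable_mul (h : IsTestFun φ U) {f : ℝ → ℝ} (hf : LocallyIntegrableOn f U) :
    Integrable fun x => f x * φ x := by
  have h1 : IntegrableOn (fun x => f x * φ x) (tsupport φ) :=
    (hf.integrableOn_compact_subset h.3 h.2).mul_continuousOn h.1.continuous.continuousOn h.2
  refine (integrableOn_iff_integrable_of_support_subset fun x hx => ?_).1 h1
  exact subset_tsupport φ (right_ne_zero_of_mul hx)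

/-- A test function on an interval with vanishing integral is the derivative of a test function. -/
lemma exists_deriv_eq {a b : ℝ} (h : IsTestFun φ (Set.Ioo a b)) (h0 : ∫ x, φ x = 0) :
    ∃ ψ : ℝ → ℝ, IsTestFun ψ (Set.Ioo a b) ∧ _root_.deriv ψ = φ := by
  obtain ⟨c, d, hac, hdb, hcd⟩ : ∃ c d, a < c ∧ d < b ∧ tsupport φ ⊆ Set.Icc c d := by
    rcases (tsupport φ).eq_empty_or_nonempty with he | hne
    · exact ⟨a + 1, b - 1, by linarith, by linarith, by simp [he]⟩
    · obtain ⟨c, hc⟩ := h.2.exists_isLeast hne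
      obtain ⟨d, hd⟩ := h.2.exists_isGreatest hne
      exact ⟨c, d, (h.3 hc.1).1, (h.3 hd.1).2, fun x hx => ⟨hc.2 hx, hd.2 hx⟩⟩
  have hcont := h.1.continuous
  have hder : ∀ x, HasDerivAt (fun x => ∫ t in c..x, φ t) (φ x) x := fun x =>
    intervalIntegral.integral_hasDerivAt_right (hcont.intervalIntegrable _ _)
      (hcont.stronglyMeasurableAtFilter _ _) hcont.continuousAt
  have hd' : _root_.deriv (fun x => ∫ t in c..x, φ t) = φ := funext fun x => (hder x).deriv
  have hz : ∀ x, x ∉ Set.Icc c d → φ x = 0 := fun x hx =>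
    image_eq_zero_of_notMem_tsupport fun h' => hx (hcd h')
  have hsupp : tsupport (fun x => ∫ t in c..x, φ t) ⊆ Set.Icc c d := by
    refine closure_minimal (fun x hx => ?_) isClosed_Icc
    by_contra hxI
    refine hx ?_
    by_cases hxc : x < c
    · refine (intervalIntegral.integral_congr_uIoo (g := 0) fun t ht => ?_).trans (by simp)
      rw [Set.uIoo_of_gt hxc] at ht
      exact hz t fun h' => absurd h'.1 (not_le.2 ht.2)
    · have hxd : d < x := by
        by_contra hxd
        exact hxI ⟨not_lt.1 hxc, not_lt.1 hxd⟩
      simp only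
      rw [intervalIntegral.integral_of_le (not_lt.1 hxc), ← integral_Icc_eq_integral_Ioc, ← h0]
      refine setIntegral_eq_integral_of_forall_compl_eq_zero fun t ht => hz t fun h' => ht ?_
      exact ⟨h'.1, h'.2.trans hxd.le⟩
  refine ⟨_, ⟨?_, ?_, hsupp.trans ?_⟩, hd'⟩
  · rw [contDiff_infty_iff_deriv, hd']
    exact ⟨fun x => (hder x).differentiableAt, h.1⟩
  · exact HasCompactSupport.of_support_subset_isCompact isCompact_Icc
      (subset_closure.trans hsupp)
  · exact fun x hx => ⟨hac.trans_le hx.1, hx.2.trans_lt hdb⟩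

end IsTestFun

/-- A smooth function has its classical derivatives as weak derivatives. -/
lemma integral_mul_iteratedDeriv_of_contDiff {S φ : ℝ → ℝ} {U : Set ℝ} (hS : ContDiff ℝ ∞ S)
    (hφ : IsTestFun φ U) (j : ℕ) :
    ∫ x, S x * iteratedDeriv j φ x = (-1) ^ j * ∫ x, iteratedDeriv j S x * φ x := by
  induction j generalizing φ with
  | zero => simp
  | succ j ih =>
    rw [iteratedDeriv_succ', ih hφ.deriv, iteratedDeriv_succ, pow_succ]
    have hSj : ContDiff ℝ ∞ (iteratedDeriv j S) := by
      rw [iteratedDeriv_eq_iterate]; exact ContDiff.iterate_deriv j hS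
    have hl : ∀ {T : ℝ → ℝ}, Continuous T → LocallyIntegrableOn T U := fun hT =>
      hT.locallyIntegrable.locallyIntegrableOn U
    rw [integral_mul_deriv_eq_deriv_mul_of_integrable (u' := deriv (iteratedDeriv j S))
      (fun x _ => (hSj.differentiable (by simp) x).hasDerivAt)
      (fun x _ => (hφ.1.differentiable (by simp) x).hasDerivAt)
      (hφ.deriv.integrable_mul (hl hSj.continuous))
      (hφ.integrable_mul (hl (hSj.continuous_deriv (by simp))))
      (hφ.integrable_mul (hl hSj.continuous))]
    ring

namespace HasWeakDeriv

variable {j : ℕ} {f g f₁ g₁ : ℝ → ℝ} {U V : Set ℝ}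

lemma integral_eq (h : HasWeakDeriv j f g U) {φ : ℝ → ℝ} (hφ : IsTestFun φ U) :
    ∫ x, f x * iteratedDeriv j φ x = (-1) ^ j * ∫ x, g x * φ x := by
  rw [← hφ.setIntegral_eq, ← (hφ.iteratedDeriv j).setIntegral_eq]
  exact h.2.2 φ hφ.1 hφ.2 hφ.3

lemma of_integral_eq (hf : LocallyIntegrableOn f U) (hg : LocallyIntegrableOn g U)
    (h : ∀ φ, IsTestFun φ U → ∫ x, f x * iteratedDeriv j φ x = (-1) ^ j * ∫ x, g x * φ x) :
    HasWeakDeriv j f g U := by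
  refine ⟨hf, hg, fun φ h1 h2 h3 => ?_⟩
  have hφ : IsTestFun φ U := ⟨h1, h2, h3⟩
  rw [hφ.setIntegral_eq, (hφ.iteratedDeriv j).setIntegral_eq]
  exact h φ hφ

lemma ae_eq (h : HasWeakDeriv j f g U) (h' : HasWeakDeriv j f g₁ U) (hU : IsOpen U) :
    g =ᵐ[volume.restrict U] g₁ := by
  have := hU.ae_eq_zero_of_integral_contDiff_smul_eq_zero (f := g - g₁) (μ := volume)
    (h.2.1.sub h'.2.1) ?_
  · rw [Filter.EventuallyEq, ae_restrict_iff' hU.measurableSet]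
    filter_upwards [this] with x hx hxU
    exact sub_eq_zero.1 (hx hxU)
  · intro φ h1 h2 h3
    have hφ : IsTestFun φ U := ⟨h1, h2, h3⟩
    have e := (h.integral_eq hφ).symm.trans (h'.integral_eq hφ)
    have e' := mul_left_cancel₀ (pow_ne_zero j (by norm_num : (-1 : ℝ) ≠ 0)) e
    simp only [Pi.sub_apply, smul_eq_mul, mul_comm (φ _), sub_mul]
    rw [integral_sub (hφ.integrable_mul h.2.1) (hφ.integrable_mul h'.2.1), e', sub_self]

lemma sub (h : HasWeakDeriv j f g U) (h' : HasWeakDeriv j f₁ g₁ U) :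
    HasWeakDeriv j (fun x => f x - f₁ x) (fun x => g x - g₁ x) U := by
  refine of_integral_eq (h.1.sub h'.1) (h.2.1.sub h'.2.1) fun φ hφ => ?_
  simp only [sub_mul]
  rw [integral_sub ((hφ.iteratedDeriv j).integrable_mul h.1)
    ((hφ.iteratedDeriv j).integrable_mul h'.1),
    integral_sub (hφ.integrable_mul h.2.1) (hφ.integrable_mul h'.2.1), h.integral_eq hφ,
    h'.integral_eq hφ, mul_sub]

lemma mono (h : HasWeakDeriv j f g U) (hVU : V ⊆ U) : HasWeakDeriv j f g V :=
  of_integral_eq (h.1.mono_set hVU) (h.2.1.mono_set hVU) fun _ hφ => h.integral_eq (hφ.mono hVU)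

lemma of_contDiff (hf : ContDiff ℝ ∞ f) : HasWeakDeriv j f (iteratedDeriv j f) U :=
  of_integral_eq (hf.continuous.locallyIntegrable.locallyIntegrableOn U)
    ((hf.continuous_iteratedDeriv j
      (by exact_mod_cast le_top)).locallyIntegrable.locallyIntegrableOn U)
    fun _ hφ => integral_mul_iteratedDeriv_of_contDiff hf hφ j

lemma congr_left (h : HasWeakDeriv j f g U) (hU : IsOpen U)
    (hff : f =ᵐ[volume.restrict U] f₁) (hf₁ : LocallyIntegrableOn f₁ U) :
    HasWeakDeriv j f₁ g U := by
  refine of_integral_eq hf₁ h.2.1 fun φ hφ => ?_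
  rw [← h.integral_eq hφ]
  refine integral_congr_ae ?_
  rw [Filter.EventuallyEq, ae_restrict_iff' hU.measurableSet] at hff
  filter_upwards [hff] with x hx
  by_cases hxU : x ∈ U
  · simp only [hx hxU]
  · simp only [(hφ.iteratedDeriv j).eq_zero_of_notMem hxU, mul_zero]

end HasWeakDeriv

lemma hasWeakDeriv_weakDeriv {j : ℕ} {f g : ℝ → ℝ} {U : Set ℝ} (h : HasWeakDeriv j f g U) :
    HasWeakDeriv j f (weakDeriv j f U) U := by
  have hex : ∃ g : ℝ → ℝ, HasWeakDeriv j f g U := ⟨g, h⟩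
  rw [weakDeriv, dif_pos hex]
  exact hex.choose_spec

lemma weakDeriv_ae_eq {j : ℕ} {f g : ℝ → ℝ} {U : Set ℝ} (h : HasWeakDeriv j f g U)
    (hU : IsOpen U) : weakDeriv j f U =ᵐ[volume.restrict U] g :=
  (hasWeakDeriv_weakDeriv h).ae_eq h hU

/-! ### Functions with a square integrable weak derivative on an interval -/

/-- Higher order du Bois-Reymond lemma. In the induction step, any test function differs
from the derivative of a test function by a multiple of a fixed bump `η` with integral `1`, so
testing against `m`-th derivatives gives a multiple of the integral; subtracting the matching
multiple of `x ^ m` reduces the order. -/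
theorem exists_polynomial_of_integral_mul_iteratedDeriv_eq_zero {a b : ℝ} (hab : a < b) (m : ℕ)
    {f : ℝ → ℝ} (hf : LocallyIntegrableOn f (Set.Ioo a b))
    (h : ∀ φ, IsTestFun φ (Set.Ioo a b) → ∫ x, f x * iteratedDeriv m φ x = 0) :
    ∃ q : Polynomial ℝ, q.degree < m ∧
      f =ᵐ[volume.restrict (Set.Ioo a b)] fun x => q.eval x := by
  induction m generalizing f with
  | zero =>
    refine ⟨0, by simp, ?_⟩
    have := isOpen_Ioo.ae_eq_zero_of_integral_contDiff_smul_eq_zero (f := f) (μ := volume) hf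
      fun φ h1 h2 h3 => by simpa [mul_comm] using h φ ⟨h1, h2, h3⟩
    rw [Filter.EventuallyEq, ae_restrict_iff' measurableSet_Ioo]
    simpa using this
  | succ m ih =>
    obtain ⟨η, hη, hη1⟩ : ∃ η, IsTestFun η (Set.Ioo a b) ∧ ∫ x, η x = 1 := by
      let B : ContDiffBump ((a + b) / 2) :=
        ⟨(b - a) / 8, (b - a) / 4, by linarith, by linarith⟩
      refine ⟨B.normed volume, ⟨B.contDiff_normed, B.hasCompactSupport_normed, ?_⟩,
        B.integral_normed⟩
      rw [B.tsupport_normed_eq, Real.closedBall_eq_Icc]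
      intro x hx
      have h1 := hx.1
      have h2 := hx.2
      simp only [B] at h1 h2
      constructor <;> linarith
    set c : ℝ := ∫ x, f x * iteratedDeriv m η x
    have key : ∀ φ, IsTestFun φ (Set.Ioo a b) →
        ∫ x, f x * iteratedDeriv m φ x = c * ∫ x, φ x := by
      intro φ hφ
      have hφi : Integrable φ := hφ.1.continuous.integrable_of_hasCompactSupport hφ.2
      have hηi : Integrable η := hη.1.continuous.integrable_of_hasCompactSupport hη.2
      obtain ⟨ψ, hψ, hψd⟩ := (hφ.sub (hη.const_mul (∫ x, φ x))).exists_deriv_eq (by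
        rw [integral_sub hφi (hηi.const_mul _), integral_const_mul, hη1]; ring)
      have e := h ψ hψ
      rw [iteratedDeriv_succ', hψd] at e
      have e2 : iteratedDeriv m (fun x => φ x - (∫ x, φ x) * η x)
          = fun x => iteratedDeriv m φ x - (∫ x, φ x) * iteratedDeriv m η x := by
        funext x
        have h1 : ContDiffAt ℝ m φ x := (hφ.1.of_le (by exact_mod_cast le_top)).contDiffAt
        have h2 : ContDiffAt ℝ m η x := (hη.1.of_le (by exact_mod_cast le_top)).contDiffAt
        rw [iteratedDeriv_fun_sub h1 (contDiffAt_const.mul h2), iteratedDeriv_const_mul _ h2]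
      rw [e2] at e
      have e3 : ∀ x, f x * (iteratedDeriv m φ x - (∫ x, φ x) * iteratedDeriv m η x)
          = f x * iteratedDeriv m φ x - (∫ x, φ x) * (f x * iteratedDeriv m η x) := fun x => by
        ring
      simp only [e3] at e
      rw [integral_sub ((hφ.iteratedDeriv m).integrable_mul hf)
        (((hη.iteratedDeriv m).integrable_mul hf).const_mul _), integral_const_mul] at e
      linarith
    -- The multiple of `x ^ m` whose weak derivative of order `m` is the constant `(-1) ^ m * c`.
    set P : Polynomial ℝ := Polynomial.C ((-1) ^ m * c / m.factorial) * Polynomial.X ^ m with hP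
    have hPs : ContDiff ℝ ∞ fun x => P.eval x := by
      simpa using P.contDiff_aeval (𝕜 := ℝ) ∞
    have hPd : ∀ x, iteratedDeriv m (fun x => P.eval x) x = (-1) ^ m * c := by
      intro x
      simp only [hP, Polynomial.eval_mul, Polynomial.eval_C, Polynomial.eval_pow,
        Polynomial.eval_X]
      rw [iteratedDeriv_const_mul_field, iteratedDeriv_pow, Nat.descFactorial_self,
        Nat.sub_self, pow_zero, mul_one]
      have : (m.factorial : ℝ) ≠ 0 := by positivity
      field_simp
    have hPl : LocallyIntegrableOn (fun x => P.eval x) (Set.Ioo a b) :=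
      hPs.continuous.locallyIntegrable.locallyIntegrableOn _
    obtain ⟨q, hq, hfq⟩ := ih (hf.sub hPl) (fun φ hφ => by
      simp only [Pi.sub_apply, sub_mul]
      rw [integral_sub ((hφ.iteratedDeriv m).integrable_mul hf)
        ((hφ.iteratedDeriv m).integrable_mul hPl), key φ hφ,
        integral_mul_iteratedDeriv_of_contDiff hPs hφ]
      simp only [hPd]
      rw [integral_const_mul, ← mul_assoc, ← mul_assoc, ← mul_pow]
      simp)
    refine ⟨q + P, ?_, ?_⟩
    · refine (Polynomial.degree_add_le _ _).trans_lt (max_lt ?_ ?_)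
      · exact hq.trans (by exact_mod_cast Nat.lt_succ_self m)
      · exact (Polynomial.degree_C_mul_X_pow_le _ _).trans_lt
          (by exact_mod_cast Nat.lt_succ_self m)
    · filter_upwards [hfq] with x hx
      simp only [Pi.sub_apply] at hx
      simp only [Polynomial.eval_add]
      linarith

/-- The `m`-fold iterated primitive of `g` with base point `a`. -/
noncomputable def iterPrimitive (a : ℝ) (g : ℝ → ℝ) : ℕ → ℝ → ℝ
  | 0 => g
  | m + 1 => fun x => ∫ t in a..x, iterPrimitive a g m t

section iterPrimitive

variable {a b : ℝ} {g : ℝ → ℝ}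

lemma intervalIntegrable_iterPrimitive (hg : IntervalIntegrable g volume a b) (m : ℕ) :
    IntervalIntegrable (iterPrimitive a g m) volume a b := by
  induction m with
  | zero => exact hg
  | succ m ih =>
    exact (ih.absolutelyContinuousOnInterval_intervalIntegral
      Set.left_mem_uIcc).continuousOn.intervalIntegrable

lemma IsTestFun.integral_eq_intervalIntegral {φ : ℝ → ℝ} (hab : a ≤ b)
    (hφ : IsTestFun φ (Set.Ioo a b)) (f : ℝ → ℝ) :
    ∫ x, f x * φ x = ∫ x in a..b, f x * φ x := by
  rw [← hφ.setIntegral_eq, intervalIntegral.integral_of_le hab, integral_Ioc_eq_integral_Ioo]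

lemma integral_iterPrimitive_mul_deriv (hab : a ≤ b) (hg : IntervalIntegrable g volume a b)
    (m : ℕ) {φ : ℝ → ℝ} (hφ : IsTestFun φ (Set.Ioo a b)) :
    ∫ x, iterPrimitive a g (m + 1) x * deriv φ x = -∫ x, iterPrimitive a g m x * φ x := by
  have hm := intervalIntegrable_iterPrimitive hg m
  have hAC := hm.absolutelyContinuousOnInterval_intervalIntegral (c := a) Set.left_mem_uIcc
  rw [hφ.integral_eq_intervalIntegral hab, hφ.deriv.integral_eq_intervalIntegral hab]
  have hφAC : AbsolutelyContinuousOnInterval φ a b :=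
    (hφ.1.of_le (by simp)).contDiffOn.absolutelyContinuousOnInterval
  refine (hAC.integral_mul_deriv_eq_deriv_mul hφAC).trans ?_
  rw [hφ.eq_zero_of_notMem (x := a) (by simp), hφ.eq_zero_of_notMem (x := b) (by simp)]
  simp only [mul_zero, sub_zero, zero_sub, neg_inj]
  refine intervalIntegral.integral_congr_ae ?_
  filter_upwards [hm.ae_hasDerivAt_integral] with x hx hxI
  rw [(hx (Set.uIoc_subset_uIcc hxI) a Set.left_mem_uIcc).deriv]

lemma integral_iterPrimitive_mul_iteratedDeriv (hab : a ≤ b)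
    (hg : IntervalIntegrable g volume a b) (m j : ℕ) {φ : ℝ → ℝ}
    (hφ : IsTestFun φ (Set.Ioo a b)) :
    ∫ x, iterPrimitive a g (m + j) x * iteratedDeriv j φ x =
      (-1) ^ j * ∫ x, iterPrimitive a g m x * φ x := by
  induction j with
  | zero => simp
  | succ j ih =>
    rw [iteratedDeriv_succ, ← add_assoc, integral_iterPrimitive_mul_deriv hab hg _
      (hφ.iteratedDeriv j), ih, pow_succ]
    ring

lemma hasWeakDeriv_iterPrimitive (hab : a ≤ b) (hg : IntervalIntegrable g volume a b) (m j : ℕ) :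
    HasWeakDeriv j (iterPrimitive a g (m + j)) (iterPrimitive a g m) (Set.Ioo a b) := by
  have hl : ∀ i, LocallyIntegrableOn (iterPrimitive a g i) (Set.Ioo a b) := fun i =>
    (((intervalIntegrable_iff_integrableOn_Ioc_of_le hab).1
      (intervalIntegrable_iterPrimitive hg i)).mono_set
        Set.Ioo_subset_Ioc_self).locallyIntegrableOn
  exact .of_integral_eq (hl _) (hl _) fun φ hφ =>
    integral_iterPrimitive_mul_iteratedDeriv hab hg m j hφ

end iterPrimitive

lemma sq_setIntegral_abs_le {a b : ℝ} (hab : a < b) {g : ℝ → ℝ}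
    (hg : MemLp g 2 (volume.restrict (Set.Ioo a b))) :
    (∫ x in Set.Ioo a b, |g x|) ^ 2 ≤ (b - a) * ∫ x in Set.Ioo a b, g x ^ 2 := by
  have h1 : Integrable (fun x => |g x|) (volume.restrict (Set.Ioo a b)) :=
    (hg.integrable one_le_two).abs
  have h2 : Integrable (fun x => g x ^ 2) (volume.restrict (Set.Ioo a b)) :=
    hg.integrable_sq
  have hpos : 0 < b - a := by linarith
  set I := ∫ x in Set.Ioo a b, |g x| with hI
  set J := ∫ x in Set.Ioo a b, g x ^ 2 with hJ
  set t := I / (b - a) with ht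
  -- The variance of `|g|` about its mean value `t` is nonnegative.
  have h3 : 0 ≤ ∫ x in Set.Ioo a b, (|g x| - t) ^ 2 := integral_nonneg fun x => sq_nonneg _
  have h4 : ∫ x in Set.Ioo a b, (|g x| - t) ^ 2 = J - 2 * t * I + t ^ 2 * (b - a) := by
    have e : ∀ x, (|g x| - t) ^ 2 = g x ^ 2 - 2 * t * |g x| + t ^ 2 := fun x => by
      rw [sub_sq, sq_abs]; ring
    simp only [e]
    rw [integral_add (f := fun x => g x ^ 2 - 2 * t * |g x|) (h2.sub (h1.const_mul _))
        (integrable_const _),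
      integral_sub h2 (h1.const_mul _), integral_const_mul, ← hI, ← hJ]
    simp [hpos.le, mul_comm]
  have h5 : t * (b - a) = I := by rw [ht]; field_simp
  rw [h4] at h3
  have h6 : 0 ≤ (b - a) * (J - 2 * t * I + t ^ 2 * (b - a)) := mul_nonneg hpos.le h3
  have h7 : (b - a) * (J - 2 * t * I + t ^ 2 * (b - a))
      = (b - a) * J - 2 * (t * (b - a)) * I + (t * (b - a)) ^ 2 := by ring
  rw [h7, h5] at h6
  nlinarith

lemma _root_.MeasureTheory.MemLp.intervalIntegrable_of_two {a b : ℝ} (hab : a ≤ b) {g : ℝ → ℝ}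
    (hg : MemLp g 2 (volume.restrict (Set.Ioo a b))) : IntervalIntegrable g volume a b := by
  rw [intervalIntegrable_iff_integrableOn_Ioo_of_le hab]
  exact hg.integrable one_le_two

lemma memLp_iterPrimitive {a b : ℝ} (hab : a ≤ b) {g : ℝ → ℝ}
    (hg : MemLp g 2 (volume.restrict (Set.Ioo a b))) (m : ℕ) :
    MemLp (iterPrimitive a g m) 2 (volume.restrict (Set.Ioo a b)) := by
  induction m with
  | zero => exact hg
  | succ m ih =>
    have hc : ContinuousOn (iterPrimitive a g (m + 1)) (Set.uIcc a b) :=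
      ((ih.intervalIntegrable_of_two hab).absolutelyContinuousOnInterval_intervalIntegral
        Set.left_mem_uIcc).continuousOn
    rw [Set.uIcc_of_le hab] at hc
    obtain ⟨C, hC⟩ := isCompact_Icc.exists_bound_of_continuousOn hc
    refine MemLp.of_bound
      ((hc.mono Set.Ioo_subset_Icc_self).aestronglyMeasurable measurableSet_Ioo) C ?_
    exact (ae_restrict_iff' measurableSet_Ioo).2 (.of_forall fun x hx =>
      hC x (Set.Ioo_subset_Icc_self hx))

lemma setIntegral_sq_iterPrimitive_le {a b : ℝ} (hab : a < b) {g : ℝ → ℝ}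
    (hg : MemLp g 2 (volume.restrict (Set.Ioo a b))) (m : ℕ) :
    ∫ x in Set.Ioo a b, iterPrimitive a g m x ^ 2 ≤
      ((b - a) ^ m) ^ 2 * ∫ x in Set.Ioo a b, g x ^ 2 := by
  induction m with
  | zero => simp [iterPrimitive]
  | succ m ih =>
    have hpos : 0 < b - a := by linarith
    have hm := memLp_iterPrimitive hab.le hg m
    have hm1 := memLp_iterPrimitive hab.le hg (m + 1)
    set J := ∫ x in Set.Ioo a b, iterPrimitive a g m x ^ 2
    have hpt : ∀ x ∈ Set.Ioo a b, iterPrimitive a g (m + 1) x ^ 2 ≤ (b - a) * J := by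
      intro x hx
      refine le_trans ?_ (sq_setIntegral_abs_le hab hm)
      refine sq_le_sq.2 ?_
      rw [abs_of_nonneg (integral_nonneg fun x => abs_nonneg _)]
      refine (intervalIntegral.abs_integral_le_integral_abs hx.1.le).trans ?_
      rw [intervalIntegral.integral_of_le hx.1.le, integral_Ioc_eq_integral_Ioo]
      exact setIntegral_mono_set (hm.integrable one_le_two).abs (.of_forall fun x => abs_nonneg _)
        (Set.Ioo_subset_Ioo_right hx.2.le).eventuallyLE
    calc ∫ x in Set.Ioo a b, iterPrimitive a g (m + 1) x ^ 2
        ≤ ∫ x in Set.Ioo a b, (b - a) * J :=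
          setIntegral_mono_on hm1.integrable_sq (integrable_const _) measurableSet_Ioo hpt
      _ = (b - a) ^ 2 * J := by simp [hpos.le]; ring
      _ ≤ (b - a) ^ 2 * (((b - a) ^ m) ^ 2 * ∫ x in Set.Ioo a b, g x ^ 2) := by gcongr
      _ = _ := by ring

/-- A function with a square integrable weak derivative `g` of order `m` on an interval is
the sum of a polynomial of degree less than `m` and of the `m`-fold primitive of `g`. -/
theorem HasWeakDeriv.exists_polynomial_add_iterPrimitive {a b : ℝ} (hab : a < b) {m : ℕ}
    {f g : ℝ → ℝ} (h : HasWeakDeriv m f g (Set.Ioo a b))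
    (hg : MemLp g 2 (volume.restrict (Set.Ioo a b))) :
    ∃ q : Polynomial ℝ, q.degree < m ∧
      f =ᵐ[volume.restrict (Set.Ioo a b)] fun x => q.eval x + iterPrimitive a g m x := by
  have hF : HasWeakDeriv m (iterPrimitive a g m) g (Set.Ioo a b) := by
    simpa [iterPrimitive] using
      hasWeakDeriv_iterPrimitive hab.le (hg.intervalIntegrable_of_two hab.le) 0 m
  have hd := h.sub hF
  obtain ⟨q, hq, hfq⟩ := exists_polynomial_of_integral_mul_iteratedDeriv_eq_zero hab m hd.1
    fun φ hφ => by rw [hd.integral_eq hφ]; simp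
  refine ⟨q, hq, ?_⟩
  filter_upwards [hfq] with x hx
  linarith

/-! ### B-splines -/

section CoxDeBoor

variable {σ : ℕ → ℝ} {L : ℕ}

lemma coxDeBoor_eq_zero (hσ : MonotoneOn σ (Set.Iic L)) {q A : ℕ} (hA : A + q + 1 ≤ L) {x : ℝ}
    (hx : x ∉ Set.Ico (σ A) (σ (A + q + 1))) : coxDeBoor σ q A x = 0 := by
  induction q generalizing A with
  | zero => simpa [coxDeBoor] using hx
  | succ q ih =>
    have h1 : σ (A + q + 1) ≤ σ (A + (q + 1) + 1) := hσ (by simp; omega) (by simp; omega) (by omega)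
    have h2 : σ A ≤ σ (A + 1) := hσ (by simp; omega) (by simp; omega) (by omega)
    have e : A + 1 + q + 1 = A + (q + 1) + 1 := by omega
    rw [coxDeBoor, ih (by omega) (fun h => hx ⟨h.1, h.2.trans_le h1⟩),
      ih (by omega) (fun h => hx ⟨h2.trans h.1, by rw [← e]; exact h.2⟩)]
    simp

lemma coxDeBoor_terms_nonneg (hσ : MonotoneOn σ (Set.Iic L)) {q A : ℕ} (hA : A + q + 1 ≤ L)
    {x : ℝ} (h : 0 ≤ coxDeBoor σ q A x) :
    0 ≤ (x - σ A) / (σ (A + (q + 1)) - σ A) * coxDeBoor σ q A x ∧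
    0 ≤ (σ (A + q + 1) - x) / (σ (A + q + 1) - σ A) * coxDeBoor σ q A x := by
  by_cases hx : x ∈ Set.Ico (σ A) (σ (A + q + 1))
  · have h1 := hx.1
    have h2 := hx.2
    exact ⟨mul_nonneg (div_nonneg (by linarith) (by rw [← add_assoc]; linarith)) h,
      mul_nonneg (div_nonneg (by linarith) (by linarith)) h⟩
  · simp [coxDeBoor_eq_zero hσ hA hx]

lemma coxDeBoor_nonneg (hσ : MonotoneOn σ (Set.Iic L)) {q A : ℕ} (hA : A + q + 1 ≤ L) (x : ℝ) :
    0 ≤ coxDeBoor σ q A x := by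
  induction q generalizing A with
  | zero => exact Set.indicator_nonneg (fun _ _ => zero_le_one) x
  | succ q ih =>
    rw [coxDeBoor]
    have e : A + (q + 1) + 1 = A + 1 + q + 1 := by omega
    rw [e]
    exact add_nonneg (coxDeBoor_terms_nonneg hσ (by omega) (ih (A := A) (by omega))).1
      (coxDeBoor_terms_nonneg hσ (by omega) (ih (A := A + 1) (by omega))).2

/-- A basis function is positive in the interior of its support, and also at its left end point
if this is a knot of maximal multiplicity. The second case is what the recursion needs. -/
lemma coxDeBoor_pos (hσ : MonotoneOn σ (Set.Iic L)) {q A e : ℕ} (hA : A + q + 1 ≤ L) {x : ℝ}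
    (hx : x ∈ Set.Ico (σ e) (σ (e + 1))) (hAe : A ≤ e) (heA : e ≤ A + q)
    (h : σ A < x ∨ e = A + q) : 0 < coxDeBoor σ q A x := by
  induction q generalizing A with
  | zero =>
    obtain rfl : e = A := by omega
    simp [coxDeBoor, Set.indicator_of_mem hx]
  | succ q ih =>
    have e1 : A + (q + 1) + 1 = A + 1 + q + 1 := by omega
    rw [coxDeBoor, e1]
    have t1 := coxDeBoor_terms_nonneg hσ (by omega)
      (coxDeBoor_nonneg hσ (q := q) (A := A) (by omega) x)
    have t2 := coxDeBoor_terms_nonneg hσ (by omega)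
      (coxDeBoor_nonneg hσ (q := q) (A := A + 1) (by omega) x)
    have hAx : σ A ≤ x := (hσ (by simp; omega) (by simp; omega) hAe).trans hx.1
    by_cases he : e = A + (q + 1)
    · have h3 : x < σ (A + 1 + q + 1) := by
        have : A + 1 + q + 1 = e + 1 := by omega
        rw [this]; exact hx.2
      have h4 : σ (A + 1) ≤ x := (hσ (by simp; omega) (by simp; omega) (by omega)).trans hx.1
      refine add_pos_of_nonneg_of_pos t1.1 (mul_pos (div_pos ?_ ?_) ?_)
      · linarith
      · linarith
      · exact ih (by omega) (by omega) (by omega) (Or.inr (by omega))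
    · have hAx' : σ A < x := h.resolve_right he
      have h3 : x < σ (A + (q + 1)) :=
        hx.2.trans_le (hσ (by simp; omega) (by simp; omega) (by omega))
      refine add_pos_of_pos_of_nonneg (mul_pos (div_pos ?_ ?_) ?_) t2.2
      · linarith
      · linarith
      · exact ih (by omega) hAe (by omega) (Or.inl hAx')

lemma measurable_coxDeBoor (σ : ℕ → ℝ) (q A : ℕ) : Measurable (coxDeBoor σ q A) := by
  induction q generalizing A with
  | zero => exact measurable_const.indicator measurableSet_Ico
  | succ q ih =>
    have h1 := ih A
    have h2 := ih (A + 1)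
    change Measurable fun s => (s - σ A) / (σ (A + (q + 1)) - σ A) * coxDeBoor σ q A s +
        (σ (A + (q + 1) + 1) - s) / (σ (A + (q + 1) + 1) - σ (A + 1)) * coxDeBoor σ q (A + 1) s
    fun_prop

/-- **Marsden's identity** on a knot span. -/
theorem marsden (hσ : MonotoneOn σ (Set.Iic L)) {q e : ℕ} (hq : q ≤ e) (he : e + q + 1 ≤ L)
    {x : ℝ} (hx : x ∈ Set.Ico (σ e) (σ (e + 1))) (y : ℝ) :
    (y - x) ^ q = ∑ A ∈ Finset.range (e + 1),
      coxDeBoor σ q A x * ∏ i ∈ Finset.range q, (y - σ (A + i + 1)) := by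
  induction q with
  | zero =>
    rw [Finset.sum_eq_single_of_mem e (by simp) fun A hA hne => ?_]
    · simp [coxDeBoor, Set.indicator_of_mem hx]
    · have : x ∉ Set.Ico (σ A) (σ (A + 0 + 1)) := fun h => by
        have h1 : A + 1 ≤ e := by have := Finset.mem_range.1 hA; omega
        have h2 : σ (A + 1) ≤ σ e := hσ (by simp; omega) (by simp; omega) h1
        have h3 := h.2
        rw [add_zero] at h3
        linarith [hx.1]
      rw [coxDeBoor_eq_zero hσ (by have := Finset.mem_range.1 hA; omega) this, zero_mul]
  | succ q ih =>
    have ih := ih (by omega) (by omega)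
    -- The two ends of the shifted sum vanish on the knot span.
    have z1 : coxDeBoor σ q 0 x = 0 := coxDeBoor_eq_zero hσ (by omega) fun h => by
      have : σ (0 + q + 1) ≤ σ e := hσ (by simp; omega) (by simp; omega) (by omega)
      linarith [h.2, hx.1]
    have z2 : coxDeBoor σ q (e + 1) x = 0 := coxDeBoor_eq_zero hσ (by omega) fun h => by
      linarith [h.1, hx.2]
    set T : ℕ → ℝ := fun A => (σ (A + q + 1) - x) / (σ (A + q + 1) - σ A) * coxDeBoor σ q A x *
      ((y - σ A) * ∏ i ∈ Finset.range q, (y - σ (A + i + 1))) with hT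
    have hshift : ∑ A ∈ Finset.range (e + 1), T (A + 1) = ∑ A ∈ Finset.range (e + 1), T A := by
      have h1 := Finset.sum_range_succ T (e + 1)
      rw [Finset.sum_range_succ'] at h1
      simpa [hT, z1, z2] using h1
    have hexp : ∀ A, coxDeBoor σ (q + 1) A x * ∏ i ∈ Finset.range (q + 1), (y - σ (A + i + 1)) =
        (x - σ A) / (σ (A + q + 1) - σ A) * coxDeBoor σ q A x *
          ((∏ i ∈ Finset.range q, (y - σ (A + i + 1))) * (y - σ (A + q + 1))) + T (A + 1) := by
      intro A
      have e1 : ∏ i ∈ Finset.range (q + 1), (y - σ (A + i + 1)) =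
          (y - σ (A + 1)) * ∏ i ∈ Finset.range q, (y - σ (A + 1 + i + 1)) := by
        rw [Finset.prod_range_succ', mul_comm]
        congr 1
        exact Finset.prod_congr rfl fun i _ => by rw [show A + (i + 1) + 1 = A + 1 + i + 1 by omega]
      rw [coxDeBoor, add_mul]
      congr 1
      · rw [Finset.prod_range_succ, add_assoc]
      · rw [e1, hT, show A + (q + 1) + 1 = A + 1 + q + 1 by omega]
    rw [Finset.sum_congr rfl fun A _ => hexp A, Finset.sum_add_distrib, hshift,
      ← Finset.sum_add_distrib, pow_succ, ih, Finset.sum_mul]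
    refine Finset.sum_congr rfl fun A hA => ?_
    have hA' := Finset.mem_range.1 hA
    by_cases hxA : x ∈ Set.Ico (σ A) (σ (A + q + 1))
    · have : σ (A + q + 1) - σ A ≠ 0 := by linarith [hxA.1, hxA.2]
      rw [hT]
      field_simp
      ring
    · simp [hT, coxDeBoor_eq_zero hσ (by omega) hxA]

end CoxDeBoor

lemma exists_mem_Ico_of_mem_Ico {σ : ℕ → ℝ} {A m : ℕ} {x : ℝ}
    (hx : x ∈ Set.Ico (σ A) (σ (A + m))) :
    ∃ e, A ≤ e ∧ e < A + m ∧ x ∈ Set.Ico (σ e) (σ (e + 1)) := by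
  induction m with
  | zero => exact absurd (hx.1.trans_lt hx.2) (lt_irrefl _)
  | succ m ih =>
    by_cases h : x < σ (A + m)
    · obtain ⟨e, h1, h2, h3⟩ := ih ⟨hx.1, h⟩
      exact ⟨e, h1, by omega, h3⟩
    · exact ⟨A + m, by omega, by omega, not_lt.1 h, hx.2⟩

namespace KnotVector

variable {p n : ℕ} (K : KnotVector p n)

lemma monotoneOn : MonotoneOn K.σ (Set.Iic (n + p)) := by
  intro i _ j hj hij
  induction j, hij using Nat.le_induction with
  | base => exact le_rfl
  | succ j hij ih =>
    have hj' : j + 1 ≤ n + p := hj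
    exact (ih (show j ≤ n + p by omega)).trans (K.mono j (by omega))

lemma le_σ {i j : ℕ} (hij : i ≤ j) (hj : j ≤ n + p) : K.σ i ≤ K.σ j :=
  K.monotoneOn (show i ≤ n + p by omega) (show j ≤ n + p from hj) hij

variable {K} {A e : ℕ}

lemma σ_lt_of_mem_elements (he : e ∈ K.elements) : K.σ e < K.σ (e + 1) := by
  classical exact (Finset.mem_filter.1 he).2

lemma lt_add_of_mem_elements (he : e ∈ K.elements) : e < n + p := by
  classical exact Finset.mem_range.1 (Finset.mem_filter.1 he).1

lemma mem_elements_of_lt (h : e < n + p) (he : K.σ e < K.σ (e + 1)) : e ∈ K.elements := by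
  classical exact Finset.mem_filter.2 ⟨Finset.mem_range.2 h, he⟩

lemma le_of_mem_elements (he : e ∈ K.elements) : p ≤ e := by
  by_contra h
  have h1 := K.le_σ (Nat.zero_le e) (lt_add_of_mem_elements he).le
  have h2 := K.le_σ (show e + 1 ≤ p by omega) (by omega)
  linarith [σ_lt_of_mem_elements he, K.open_left]

lemma lt_of_mem_elements (he : e ∈ K.elements) : e < n := by
  by_contra h
  have h0 := lt_add_of_mem_elements he
  have h1 := K.le_σ (show n ≤ e by omega) h0.le
  have h2 := K.le_σ (show e + 1 ≤ n + p by omega) le_rfl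
  linarith [σ_lt_of_mem_elements he, K.open_right]

lemma meshSize_pos (he : e ∈ K.elements) : 0 < K.meshSize e :=
  sub_pos.2 (σ_lt_of_mem_elements he)

lemma N_nonneg (hA : A < n) (x : ℝ) : 0 ≤ K.N A x :=
  coxDeBoor_nonneg K.monotoneOn (by omega) x

lemma N_eq_zero (hA : A < n) {x : ℝ} (hx : x ∉ Set.Ico (K.σ A) (K.σ (A + p + 1))) :
    K.N A x = 0 :=
  coxDeBoor_eq_zero K.monotoneOn (by omega) hx

lemma N_eq_zero_of_mem (hA : A < n) (he : e < n + p) {x : ℝ}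
    (hx : x ∈ Set.Ico (K.σ e) (K.σ (e + 1))) (h : ¬(A ≤ e ∧ e ≤ A + p)) : K.N A x = 0 := by
  refine N_eq_zero hA fun hx' => ?_
  rcases not_and_or.1 h with h | h
  · have := K.le_σ (show e + 1 ≤ A by omega) (by omega)
    linarith [hx.2, hx'.1]
  · have := K.le_σ (show A + p + 1 ≤ e by omega) (by omega)
    linarith [hx.1, hx'.2]

lemma N_pos (hA : A < n) {x : ℝ} (hx : x ∈ Set.Ioo (K.σ A) (K.σ (A + p + 1))) :
    0 < K.N A x := by
  obtain ⟨e, h1, h2, h3⟩ := exists_mem_Ico_of_mem_Ico (m := p + 1) ⟨hx.1.le, hx.2⟩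
  exact coxDeBoor_pos K.monotoneOn (by omega) h3 h1 (by omega) (Or.inl hx.1)

lemma measurable_N (A : ℕ) : Measurable (K.N A) := measurable_coxDeBoor _ _ _

lemma tsupport_N (hA : A < n) : tsupport (K.N A) = Set.Icc (K.σ A) (K.σ (A + p + 1)) := by
  apply Set.Subset.antisymm
  · refine closure_minimal (fun x hx => ?_) isClosed_Icc
    by_contra h
    exact hx (N_eq_zero hA fun h' => h (Set.Ico_subset_Icc_self h'))
  · rw [← closure_Ioo (K.nondegenerate A hA).ne]
    exact closure_mono fun x hx => (N_pos hA hx).ne'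

lemma overlaps_iff (he : e ∈ K.elements) (hA : A < n) :
    K.Overlaps A e ↔ A ≤ e ∧ e ≤ A + p := by
  rw [Overlaps, tsupport_N hA, elemDomain]
  have hlt := σ_lt_of_mem_elements he
  have hen := lt_of_mem_elements he
  constructor
  · rintro ⟨x, h1, h2⟩
    constructor
    · by_contra h
      have := K.le_σ (show e + 1 ≤ A by omega) (by omega)
      linarith [h1.1, h2.2]
    · by_contra h
      have := K.le_σ (show A + p + 1 ≤ e by omega) (by omega)
      linarith [h1.2, h2.1]
  · rintro ⟨h1, h2⟩
    have h3 := K.le_σ h1 (by omega)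
    have h4 := K.le_σ (show e + 1 ≤ A + p + 1 by omega) (by omega)
    refine ⟨(K.σ e + K.σ (e + 1)) / 2, ⟨?_, ?_⟩, ?_, ?_⟩ <;> linarith

lemma mem_supportElements_iff (hA : A < n) :
    e ∈ K.supportElements A ↔ e ∈ K.elements ∧ A ≤ e ∧ e ≤ A + p := by
  classical
  rw [supportElements, Finset.mem_filter]
  exact and_congr_right fun he => overlaps_iff he hA

lemma globalIndex_lt (he : e ∈ K.elements) (a : Fin (p + 1)) : K.globalIndex e a < n := by
  have h1 := le_of_mem_elements he
  have h2 := lt_of_mem_elements he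
  have h3 := a.2
  simp only [globalIndex]
  omega

lemma mem_supportElements_globalIndex (he : e ∈ K.elements) (a : Fin (p + 1)) :
    e ∈ K.supportElements (K.globalIndex e a) := by
  have h1 := le_of_mem_elements he
  have h3 := a.2
  refine (mem_supportElements_iff (globalIndex_lt he a)).2 ⟨he, ?_, ?_⟩ <;>
    simp only [globalIndex] <;> omega

lemma exists_globalIndex_eq (hA : A < n) (he : e ∈ K.supportElements A) :
    ∃ a : Fin (p + 1), K.globalIndex e a = A := by
  obtain ⟨h1, h2, h3⟩ := (mem_supportElements_iff hA).1 he
  have h4 := le_of_mem_elements h1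
  exact ⟨⟨A - (e - p), by omega⟩, by simp only [globalIndex]; omega⟩

lemma globalIndex_injective : Function.Injective (K.globalIndex e) := fun a b h => by
  simp only [globalIndex] at h
  exact Fin.ext (by omega)

lemma supportExtension_eq (he : e ∈ K.elements) :
    K.supportExtension e = Set.Ioo (K.σ (e - p)) (K.σ (e + p + 1)) := by
  have hpe := le_of_mem_elements he
  have hen := lt_of_mem_elements he
  rw [supportExtension, ← interior_Icc]
  congr 1
  apply Set.Subset.antisymm
  · refine Set.iUnion₂_subset fun A hA => ?_
    obtain ⟨hAn, hA⟩ := hA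
    rw [overlaps_iff he hAn] at hA
    rw [tsupport_N hAn]
    exact Set.Icc_subset_Icc (K.le_σ (by omega) (by omega)) (K.le_σ (by omega) (by omega))
  · intro x hx
    rcases le_or_gt x (K.σ (e + 1)) with h | h
    · refine Set.mem_iUnion₂.2 ⟨e - p, ⟨by omega, (overlaps_iff he (by omega)).2 (by omega)⟩, ?_⟩
      rw [tsupport_N (by omega), Nat.sub_add_cancel hpe]
      exact ⟨hx.1, h⟩
    · refine Set.mem_iUnion₂.2 ⟨e, ⟨hen, (overlaps_iff he hen).2 (by omega)⟩, ?_⟩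
      rw [tsupport_N hen]
      exact ⟨(σ_lt_of_mem_elements he).le.trans h.le, hx.2⟩

lemma elemDomain_subset_supportExtension {e' : ℕ} (he : e ∈ K.elements) (hA : A < n)
    (hAe : e ∈ K.supportElements A) (hAe' : e' ∈ K.supportElements A) :
    K.elemDomain e' ⊆ K.supportExtension e := by
  obtain ⟨-, h2, h3⟩ := (mem_supportElements_iff hA).1 hAe
  obtain ⟨h4, h5, h6⟩ := (mem_supportElements_iff hA).1 hAe'
  have := lt_of_mem_elements h4
  have := lt_of_mem_elements he
  rw [supportExtension_eq he]
  exact Set.Ioo_subset_Ioo (K.le_σ (by omega) (by omega)) (K.le_σ (by omega) (by omega))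

/-- On an element, a sum over all basis functions reduces to the local ones. -/
lemma sum_range_N_eq_sum_globalIndex (he : e ∈ K.elements) {m : ℕ} (hm : e < m) (hmn : m ≤ n)
    (c : ℕ → ℝ) {x : ℝ} (hx : x ∈ K.elemDomain e) :
    ∑ A ∈ Finset.range m, c A * K.N A x =
      ∑ a : Fin (p + 1), c (K.globalIndex e a) * K.N (K.globalIndex e a) x := by
  have hpe := le_of_mem_elements he
  have hen := lt_of_mem_elements he
  have hsub : Finset.Ico (e - p) (e + 1) ⊆ Finset.range m := fun A hA => by
    simp only [Finset.mem_Ico, Finset.mem_range] at hA ⊢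
    omega
  rw [← Finset.sum_subset hsub fun A hA hA' => ?_, Finset.sum_Ico_eq_sum_range,
    show e + 1 - (e - p) = p + 1 by omega]
  · exact (Fin.sum_univ_eq_sum_range (fun i => c (e - p + i) * K.N (e - p + i) x) (p + 1)).symm
  · simp only [Finset.mem_Ico, Finset.mem_range] at hA hA'
    rw [N_eq_zero_of_mem (by omega) (by omega) (Set.Ioo_subset_Ico_self hx) (by omega), mul_zero]

/-- Marsden's identity in terms of the local basis functions. -/
lemma marsden_local (he : e ∈ K.elements) {x : ℝ} (hx : x ∈ K.elemDomain e) (y : ℝ) :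
    (y - x) ^ p = ∑ a : Fin (p + 1), K.N (K.globalIndex e a) x *
      ∏ i ∈ Finset.range p, (y - K.σ (K.globalIndex e a + i + 1)) := by
  have hpe := le_of_mem_elements he
  have hen := lt_of_mem_elements he
  rw [marsden K.monotoneOn hpe (by omega) (Set.Ioo_subset_Ico_self hx) y]
  have := sum_range_N_eq_sum_globalIndex he (Nat.lt_succ_self e) hen
    (fun A => ∏ i ∈ Finset.range p, (y - K.σ (A + i + 1))) hx
  simp only [mul_comm] at this ⊢
  exact this

/-! ### Shape regular meshes -/

/-- Under shape regularity with a constant `θ ≥ 1`, walking from the element `e` to the right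
past `i` knots multiplies the mesh size by at most `θ ^ i`. The element `e'` is the last one
that ends at or before the knot reached; repeated knots do not change it. -/
lemma ShapeRegular.exists_element {θ : ℝ} (hK : K.ShapeRegular θ) (hθ : 1 ≤ θ)
    (he : e ∈ K.elements) (i : ℕ) (hi : e + i < n + p) :
    ∃ e' ∈ K.elements, K.σ (e' + 1) = K.σ (e + i + 1) ∧
      K.meshSize e' ≤ θ ^ i * K.meshSize e ∧ K.meshSize e ≤ θ ^ i * K.meshSize e' ∧
      (K.σ (e + i) < K.σ (e + i + 1) → e' = e + i) := by
  induction i with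
  | zero => exact ⟨e, he, rfl, by simp, by simp, fun _ => rfl⟩
  | succ i ih =>
    obtain ⟨e', he', h1, h2, h3, h4⟩ := ih (by omega)
    have hθ0 : 0 ≤ θ := by linarith
    have hpow : θ ^ i ≤ θ ^ (i + 1) := pow_le_pow_right₀ hθ (by omega)
    rcases (K.mono (e + (i + 1)) hi).eq_or_lt with h | h
    · refine ⟨e', he', by rw [h1, ← h, add_assoc], h2.trans ?_, h3.trans ?_, fun h' => ?_⟩
      · exact mul_le_mul_of_nonneg_right hpow (meshSize_pos he).le
      · exact mul_le_mul_of_nonneg_right hpow (meshSize_pos he').le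
      · exact absurd h h'.ne
    · have hmem := mem_elements_of_lt hi h
      obtain ⟨h5, h6⟩ := hK e' he' (e + (i + 1)) hmem h1
      refine ⟨e + (i + 1), hmem, rfl, ?_, ?_, fun _ => rfl⟩
      · calc K.meshSize (e + (i + 1)) ≤ θ * K.meshSize e' := h6
          _ ≤ θ * (θ ^ i * K.meshSize e) := by gcongr
          _ = _ := by ring
      · calc K.meshSize e ≤ θ ^ i * K.meshSize e' := h3
          _ ≤ θ ^ i * (θ * K.meshSize (e + (i + 1))) := by gcongr
          _ = _ := by ring

lemma ShapeRegular.meshSize_le {θ : ℝ} (hK : K.ShapeRegular θ) (hθ : 1 ≤ θ) {e' : ℕ}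
    (he : e ∈ K.elements) (he' : e' ∈ K.elements) {d : ℕ} (h1 : e ≤ e' + d) (h2 : e' ≤ e + d) :
    K.meshSize e ≤ θ ^ d * K.meshSize e' := by
  have aux : ∀ {i}, i ≤ d → θ ^ i ≤ θ ^ d := fun h => pow_le_pow_right₀ hθ h
  rcases le_total e e' with h | h
  · obtain ⟨i, rfl⟩ := Nat.exists_eq_add_of_le h
    obtain ⟨e'', -, -, -, h3, h4⟩ := hK.exists_element hθ he i (lt_add_of_mem_elements he')
    obtain rfl := h4 (σ_lt_of_mem_elements he')
    exact h3.trans (mul_le_mul_of_nonneg_right (aux (by omega)) (meshSize_pos he').le)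
  · obtain ⟨i, rfl⟩ := Nat.exists_eq_add_of_le h
    obtain ⟨e'', -, -, h3, -, h4⟩ := hK.exists_element hθ he' i (lt_add_of_mem_elements he)
    obtain rfl := h4 (σ_lt_of_mem_elements he)
    exact h3.trans (mul_le_mul_of_nonneg_right (aux (by omega)) (meshSize_pos he').le)

/-- The support extension of an element is at most a fixed multiple longer than the element. -/
lemma ShapeRegular.σ_sub_σ_le {θ : ℝ} (hK : K.ShapeRegular θ) (hθ : 1 ≤ θ)
    (he : e ∈ K.elements) :
    K.σ (e + p + 1) - K.σ (e - p) ≤ (2 * p + 1) * θ ^ p * K.meshSize e := by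
  have hpe := le_of_mem_elements he
  have hen := lt_of_mem_elements he
  have hspan : ∀ i < 2 * p + 1, K.σ (e - p + (i + 1)) - K.σ (e - p + i) ≤
      θ ^ p * K.meshSize e := by
    intro i hi
    rcases (K.mono (e - p + i) (by omega)).eq_or_lt with h | h
    · rw [← add_assoc, ← h, sub_self]
      have := meshSize_pos he
      positivity
    · exact hK.meshSize_le hθ (mem_elements_of_lt (by omega) h) he (by omega) (by omega)
  have := Finset.sum_range_sub (fun i => K.σ (e - p + i)) (2 * p + 1)
  rw [show e - p + (2 * p + 1) = e + p + 1 by omega, add_zero] at this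
  rw [← this]
  refine (Finset.sum_le_sum fun i hi => hspan i (Finset.mem_range.1 hi)).trans ?_
  simp
  exact le_of_eq (by ring)

end KnotVector

/-! ### Polar forms of polynomials -/

open Polynomial in
/-- The polar form (blossom) of a polynomial `q` of degree at most `p`, evaluated at
`u 0, …, u (p - 1)`: the symmetric `p`-affine form with diagonal `q`. Up to sign, the polar form
of `X ^ j` is the elementary symmetric polynomial of degree `j` divided by `p.choose j`, which
is read off here as a coefficient of `∏ i, (X - u i)`. -/
noncomputable def polarForm (p : ℕ) (q : ℝ[X]) (u : ℕ → ℝ) : ℝ :=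
  ∑ j ∈ Finset.range (p + 1), q.coeff j *
    ((-1) ^ j / (p.choose j : ℝ) * (∏ i ∈ Finset.range p, (X - C (u i))).coeff (p - j))

open Polynomial in
/-- Marsden's identity, valid for all powers `(y - x) ^ p`, gives the expansion of every
polynomial of degree at most `p` by comparing coefficients in `y`. -/
lemma eval_eq_sum_polarForm {ι : Type*} [Fintype ι] {p : ℕ} {w : ι → ℝ} {u : ι → ℕ → ℝ} {x : ℝ}
    (h : ∀ y, (y - x) ^ p = ∑ a, w a * ∏ i ∈ Finset.range p, (y - u a i)) {q : ℝ[X]}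
    (hq : q.natDegree ≤ p) : q.eval x = ∑ a, w a * polarForm p q (u a) := by
  have hpoly : (X + C (-x)) ^ p =
      ∑ a, C (w a) * ∏ i ∈ Finset.range p, (X - C (u a i)) := by
    refine Polynomial.funext fun y => ?_
    simpa [eval_finsetSum, eval_prod, sub_eq_add_neg] using h y
  have hcoeff : ∀ j ∈ Finset.range (p + 1), (-x) ^ j * (p.choose j : ℝ) =
      ∑ a, w a * (∏ i ∈ Finset.range p, (X - C (u a i))).coeff (p - j) := by
    intro j hj
    have hj' : j ≤ p := by have := Finset.mem_range.1 hj; omega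
    have := congrArg (fun r => coeff r (p - j)) hpoly
    simp only [coeff_X_add_C_pow, finsetSum_coeff, coeff_C_mul] at this
    rwa [Nat.sub_sub_self hj', Nat.choose_symm hj'] at this
  simp only [polarForm, Finset.mul_sum]
  rw [Finset.sum_comm, eval_eq_sum_range' (Nat.lt_succ_of_le hq)]
  refine Finset.sum_congr rfl fun j hj => ?_
  have hne : (p.choose j : ℝ) ≠ 0 := by
    have := Nat.choose_pos (show j ≤ p by have := Finset.mem_range.1 hj; omega)
    positivity
  have e : ∀ a, w a * (q.coeff j * ((-1) ^ j / (p.choose j : ℝ) *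
      (∏ i ∈ Finset.range p, (X - C (u a i))).coeff (p - j))) =
      q.coeff j * ((-1) ^ j / (p.choose j : ℝ)) * (w a *
      (∏ i ∈ Finset.range p, (X - C (u a i))).coeff (p - j)) := fun a => by ring
  rw [Finset.sum_congr rfl fun a _ => e a, ← Finset.mul_sum, ← hcoeff j hj, neg_pow x j]
  have h1 : ((-1 : ℝ) ^ j) * (-1) ^ j = 1 := by rw [← mul_pow]; simp
  field_simp
  linear_combination (-(q.coeff j * x ^ j)) * h1

open Polynomial in
lemma abs_coeff_prod_X_sub_C_le {R : ℝ} {u : ℕ → ℝ} {m : ℕ} (hu : ∀ i < m, |u i| ≤ R)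
    (hR : 0 ≤ R) (k : ℕ) : |(∏ i ∈ Finset.range m, (X - C (u i))).coeff k| ≤ (1 + R) ^ m := by
  induction m generalizing k with
  | zero =>
    simp only [Finset.range_zero, Finset.prod_empty, coeff_one, pow_zero]
    split_ifs <;> simp
  | succ m ih =>
    have ih := ih fun i hi => hu i (by omega)
    have hum := hu m (by omega)
    rw [Finset.prod_range_succ, mul_sub, coeff_sub, coeff_mul_C, pow_succ]
    set P := ∏ i ∈ Finset.range m, (X - C (u i))
    have h1 : |(P * X).coeff k| ≤ (1 + R) ^ m := by
      cases k with
      | zero => simp; positivity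
      | succ k => rw [coeff_mul_X]; exact ih k
    calc |(P * X).coeff k - P.coeff k * u m|
        ≤ |(P * X).coeff k| + |P.coeff k| * |u m| := by rw [← abs_mul]; exact abs_sub _ _
      _ ≤ (1 + R) ^ m + (1 + R) ^ m * R := by gcongr; exact ih k
      _ = _ := by ring

lemma abs_polarForm_le {p : ℕ} (q : Polynomial ℝ) {u : ℕ → ℝ} {R : ℝ} (hR : 0 ≤ R)
    (hu : ∀ i < p, |u i| ≤ R) :
    |polarForm p q u| ≤ ∑ j ∈ Finset.range (p + 1), |q.coeff j| * (1 + R) ^ p := by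
  refine (Finset.abs_sum_le_sum_abs _ _).trans (Finset.sum_le_sum fun j hj => ?_)
  have hc : (1 : ℝ) ≤ p.choose j := by
    exact_mod_cast Nat.choose_pos (show j ≤ p by have := Finset.mem_range.1 hj; omega)
  rw [abs_mul, abs_mul, abs_div, abs_pow]
  simp only [abs_neg, abs_one, one_pow, Nat.abs_cast]
  refine mul_le_mul_of_nonneg_left ?_ (abs_nonneg _)
  calc 1 / (p.choose j : ℝ) * _ ≤ 1 * _ := by
        gcongr
        exact div_le_one_of_le₀ hc (by positivity)
    _ ≤ _ := by rw [one_mul]; exact abs_coeff_prod_X_sub_C_le hu hR _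

/-! ### The Bernstein basis -/

/-- The Bernstein basis polynomial on `[-1, 1]` as a formal polynomial. -/
noncomputable def bernsteinBPoly (p : ℕ) (i : Fin (p + 1)) : Polynomial ℝ :=
  .C (1 / 2 ^ p * (p.choose i : ℝ)) * (1 - .X) ^ (p - (i : ℕ)) * (1 + .X) ^ (i : ℕ)

lemma eval_bernsteinBPoly (p : ℕ) (i : Fin (p + 1)) (ξ : ℝ) :
    (bernsteinBPoly p i).eval ξ = bernsteinB p i ξ := by
  simp [bernsteinBPoly, bernsteinB]

open Polynomial in
lemma natDegree_bernsteinBPoly_le (p : ℕ) (i : Fin (p + 1)) :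
    (bernsteinBPoly p i).natDegree ≤ p := by
  have hi : (i : ℕ) ≤ p := by omega
  have h1 : (1 - X : ℝ[X]).natDegree ≤ 1 := (natDegree_sub_le _ _).trans (by simp)
  have h2 : (1 + X : ℝ[X]).natDegree ≤ 1 := (natDegree_add_le _ _).trans (by simp)
  have h3 : ((1 - X : ℝ[X]) ^ (p - (i : ℕ))).natDegree ≤ (p - i) * 1 :=
    natDegree_pow_le_of_le _ h1
  have h4 : ((1 + X : ℝ[X]) ^ (i : ℕ)).natDegree ≤ i * 1 := natDegree_pow_le_of_le _ h2
  rw [bernsteinBPoly, mul_assoc]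
  refine (natDegree_C_mul_le _ _).trans (natDegree_mul_le.trans ?_)
  omega

lemma contDiff_bernsteinB (p : ℕ) (i : Fin (p + 1)) : ContDiff ℝ ∞ (bernsteinB p i) := by
  unfold bernsteinB
  fun_prop

lemma exists_abs_iteratedDeriv_bernsteinB_le (p j : ℕ) :
    ∃ B : ℝ, 0 ≤ B ∧ ∀ i : Fin (p + 1), ∀ ξ ∈ Set.Ioo (-1 : ℝ) 1,
      |iteratedDeriv j (bernsteinB p i) ξ| ≤ B := by
  have h : ∀ i : Fin (p + 1), ∃ C, ∀ ξ ∈ Set.Icc (-1 : ℝ) 1,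
      ‖iteratedDeriv j (bernsteinB p i) ξ‖ ≤ C := fun i =>
    isCompact_Icc.exists_bound_of_continuousOn ((contDiff_bernsteinB p i).continuous_iteratedDeriv j
      (by exact_mod_cast le_top)).continuousOn
  choose C hC using h
  refine ⟨∑ i, |C i|, Finset.sum_nonneg fun i _ => abs_nonneg _, fun i ξ hξ => ?_⟩
  exact ((hC i ξ (Set.Ioo_subset_Icc_self hξ)).trans (le_abs_self _)).trans
    (Finset.single_le_sum (f := fun i => |C i|) (fun i _ => abs_nonneg _) (Finset.mem_univ i))

open Polynomial in
lemma eq_zero_of_sum_mul_bernsteinB_eq_zero {p : ℕ} {c : Fin (p + 1) → ℝ}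
    (h : ∀ ξ ∈ Set.Ioo (-1 : ℝ) 1, ∑ i, c i * bernsteinB p i ξ = 0) : c = 0 := by
  -- The substitution `ξ = (t - 1) / (t + 1)` turns the combination into a polynomial in `t`.
  set P : ℝ[X] := ∑ i : Fin (p + 1), C (c i * (p.choose i : ℝ)) * X ^ (i : ℕ) with hP
  have hroot : ∀ t : ℝ, 0 < t → P.eval t = 0 := by
    intro t ht
    have ht1 : 0 < t + 1 := by linarith
    have hξ := h ((t - 1) / (t + 1)) ⟨by rw [lt_div_iff₀ ht1]; linarith, by
      rw [div_lt_one ht1]; linarith⟩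
    have e : ∀ i : Fin (p + 1), c i * bernsteinB p i ((t - 1) / (t + 1)) =
        (1 / (t + 1) ^ p) * (c i * (p.choose i : ℝ) * t ^ (i : ℕ)) := by
      intro i
      have h1 : 1 - (t - 1) / (t + 1) = 2 / (t + 1) := by field_simp; ring
      have h2 : 1 + (t - 1) / (t + 1) = 2 * t / (t + 1) := by field_simp; ring
      have h3 : (2 / (t + 1)) ^ (p - (i : ℕ)) * (2 / (t + 1)) ^ (i : ℕ) = (2 / (t + 1)) ^ p := by
        rw [← pow_add, Nat.sub_add_cancel (by omega)]
      have h4 : (2 * t / (t + 1)) ^ (i : ℕ) = (2 / (t + 1)) ^ (i : ℕ) * t ^ (i : ℕ) := by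
        rw [← mul_pow]; congr 1; ring
      rw [bernsteinB, h1, h2, h4]
      calc _ = c i * (1 / 2 ^ p * (p.choose i : ℝ) *
            ((2 / (t + 1)) ^ (p - (i : ℕ)) * (2 / (t + 1)) ^ (i : ℕ)) * t ^ (i : ℕ)) := by ring
        _ = _ := by rw [h3, div_pow]; field_simp
    rw [Finset.sum_congr rfl fun i _ => e i, ← Finset.mul_sum] at hξ
    have := (mul_eq_zero.1 hξ).resolve_left (by positivity)
    simpa [hP, eval_finsetSum] using this
  have hP0 : P = 0 := by
    refine Polynomial.eq_zero_of_infinite_isRoot P ((Set.Ioi_infinite (0 : ℝ)).mono ?_)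
    exact fun t ht => hroot t ht
  funext i
  have := congrArg (fun r => coeff r (i : ℕ)) hP0
  simp only [hP, finsetSum_coeff, coeff_C_mul, coeff_X_pow, coeff_zero, mul_ite, mul_one,
    mul_zero] at this
  rw [Finset.sum_eq_single i (fun b _ hb => if_neg fun h => hb (Fin.ext h.symm)) (by simp),
    if_pos rfl] at this
  refine (mul_eq_zero.1 this).resolve_right ?_
  have := Nat.choose_pos (show (i : ℕ) ≤ p by omega)
  positivity

lemma continuous_bernsteinB (p : ℕ) (i : Fin (p + 1)) : Continuous (bernsteinB p i) :=
  (contDiff_bernsteinB p i).continuous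

lemma gramian_mulVec (p : ℕ) (c : Fin (p + 1) → ℝ) (i : Fin (p + 1)) :
    (gramian p).mulVec c i =
      ∫ ξ in (-1 : ℝ)..1, bernsteinB p i ξ * ∑ j, c j * bernsteinB p j ξ := by
  simp only [Matrix.mulVec, dotProduct, gramian, Matrix.of_apply, Finset.mul_sum]
  rw [intervalIntegral.integral_finsetSum fun j _ => Continuous.intervalIntegrable (by
    have := continuous_bernsteinB p
    fun_prop) _ _]
  refine Finset.sum_congr rfl fun j _ => ?_
  rw [← intervalIntegral.integral_mul_const]
  exact intervalIntegral.integral_congr fun ξ _ => by ring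

lemma isUnit_det_gramian (p : ℕ) : IsUnit (gramian p).det := by
  rw [isUnit_iff_ne_zero]
  intro h0
  obtain ⟨c, hc, hGc⟩ := Matrix.exists_mulVec_eq_zero_iff.2 h0
  refine hc (eq_zero_of_sum_mul_bernsteinB_eq_zero ?_)
  have hcont : Continuous fun ξ => ∑ j, c j * bernsteinB p j ξ := by
    have := continuous_bernsteinB p
    fun_prop
  -- `c` annihilates the Gramian, so the square of the combination has integral zero.
  have hint : ∫ ξ in (-1 : ℝ)..1, (∑ j, c j * bernsteinB p j ξ) ^ 2 = 0 := by
    have e : ∀ ξ, (∑ j, c j * bernsteinB p j ξ) ^ 2 =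
        ∑ i, c i * (bernsteinB p i ξ * ∑ j, c j * bernsteinB p j ξ) := fun ξ => by
      rw [sq, Finset.sum_mul]
      exact Finset.sum_congr rfl fun i _ => by ring
    simp only [e]
    rw [intervalIntegral.integral_finsetSum fun i _ => Continuous.intervalIntegrable (by
      have := continuous_bernsteinB p
      fun_prop) _ _]
    refine Finset.sum_eq_zero fun i _ => ?_
    rw [intervalIntegral.integral_const_mul, ← gramian_mulVec, hGc]
    simp
  intro ξ hξ
  by_contra hne
  have : 0 < ∫ ξ in (-1 : ℝ)..1, (∑ j, c j * bernsteinB p j ξ) ^ 2 :=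
    intervalIntegral.integral_pos (by norm_num) (hcont.pow 2).continuousOn
      (fun x _ => sq_nonneg _) ⟨ξ, Set.Ioo_subset_Icc_self hξ, by positivity⟩
  exact this.ne' hint

namespace KnotVector

variable {p n : ℕ} {K : KnotVector p n} {e A : ℕ}

/-! ### The element extraction operator -/

/-- The inverse of `elemMap`: the coordinate in `[-1, 1]` of a point of the element. -/
noncomputable def elemCoord (K : KnotVector p n) (e : ℕ) (x : ℝ) : ℝ :=
  (K.meshSize e / 2)⁻¹ * (x - (K.σ e + K.σ (e + 1)) / 2)

lemma elemCoord_elemMap (he : e ∈ K.elements) (ξ : ℝ) :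
    K.elemCoord e (K.elemMap e ξ) = ξ := by
  have := (meshSize_pos he).ne'
  simp only [elemCoord, elemMap]
  field_simp
  ring

lemma elemMap_elemCoord (he : e ∈ K.elements) (x : ℝ) :
    K.elemMap e (K.elemCoord e x) = x := by
  have := (meshSize_pos he).ne'
  simp only [elemCoord, elemMap]
  field_simp
  ring

lemma elemMap_mem (he : e ∈ K.elements) {ξ : ℝ} (hξ : ξ ∈ Set.Ioo (-1 : ℝ) 1) :
    K.elemMap e ξ ∈ K.elemDomain e := by
  have h1 := meshSize_pos he
  have h2 := mul_lt_mul_of_pos_left hξ.1 h1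
  have h3 := mul_lt_mul_of_pos_left hξ.2 h1
  simp only [elemMap, elemDomain, meshSize] at *
  constructor <;> linarith

lemma elemCoord_mem (he : e ∈ K.elements) {x : ℝ} (hx : x ∈ K.elemDomain e) :
    K.elemCoord e x ∈ Set.Ioo (-1 : ℝ) 1 := by
  have h1 := meshSize_pos he
  obtain ⟨h2, h3⟩ := hx
  simp only [elemCoord, Set.mem_Ioo, meshSize] at *
  rw [inv_mul_eq_div, lt_div_iff₀ (by linarith), div_lt_iff₀ (by linarith)]
  constructor <;> linarith

/-- Marsden's identity in the coordinate of the element. -/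
lemma marsden_elemMap (he : e ∈ K.elements) {ξ : ℝ} (hξ : ξ ∈ Set.Ioo (-1 : ℝ) 1) (η : ℝ) :
    (η - ξ) ^ p = ∑ a : Fin (p + 1), K.N (K.globalIndex e a) (K.elemMap e ξ) *
      ∏ i ∈ Finset.range p, (η - K.elemCoord e (K.σ (K.globalIndex e a + i + 1))) := by
  have hpos := meshSize_pos he
  have hd : ∀ s t, K.elemMap e s - K.elemMap e t = K.meshSize e / 2 * (s - t) := fun s t => by
    simp only [elemMap]; ring
  have h := marsden_local he (elemMap_mem he hξ) (K.elemMap e η)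
  have hprod : ∀ a : Fin (p + 1),
      ∏ i ∈ Finset.range p, (K.elemMap e η - K.σ (K.globalIndex e a + i + 1)) =
      (K.meshSize e / 2) ^ p *
        ∏ i ∈ Finset.range p, (η - K.elemCoord e (K.σ (K.globalIndex e a + i + 1))) := by
    intro a
    have hpow : (K.meshSize e / 2) ^ p = ∏ i ∈ Finset.range p, K.meshSize e / 2 := by
      rw [Finset.prod_const, Finset.card_range]
    rw [hpow, ← Finset.prod_mul_distrib]
    refine Finset.prod_congr rfl fun i _ => ?_
    rw [← hd, elemMap_elemCoord he]
  simp only [hprod, hd, mul_pow, mul_left_comm _ ((K.meshSize e / 2) ^ p)] at h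
  rw [← Finset.mul_sum] at h
  exact mul_left_cancel₀ (by positivity) h

/-- Partition of unity: the case of the constant `1`, whose polar form is the leading coefficient
of `∏ i, (X - u i)`. -/
lemma sum_N_eq_one (he : e ∈ K.elements) {x : ℝ} (hx : x ∈ K.elemDomain e) :
    ∑ a : Fin (p + 1), K.N (K.globalIndex e a) x = 1 := by
  have h := eval_eq_sum_polarForm (fun y => marsden_local he hx y) (q := 1) (by simp)
  have h1 : ∀ u : ℕ → ℝ, polarForm p 1 u = 1 := fun u => by
    rw [polarForm, Finset.sum_eq_single_of_mem 0 (by simp) fun j _ hj => by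
      simp [Polynomial.coeff_one, hj]]
    have hm : (∏ i ∈ Finset.range p, (Polynomial.X - Polynomial.C (u i))).Monic :=
      Polynomial.monic_prod_X_sub_C _ _
    have hdeg : (∏ i ∈ Finset.range p, (Polynomial.X - Polynomial.C (u i))).natDegree = p := by
      simp
    have := hm.coeff_natDegree
    rw [hdeg] at this
    simp [this]
  simpa [h1] using h.symm

lemma N_le_one (he : e ∈ K.elements) {x : ℝ} (hx : x ∈ K.elemDomain e) (a : Fin (p + 1)) :
    K.N (K.globalIndex e a) x ≤ 1 := by
  rw [← sum_N_eq_one he hx]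
  exact Finset.single_le_sum (f := fun a => K.N (K.globalIndex e a) x)
    (fun b _ => N_nonneg (globalIndex_lt he b) x) (Finset.mem_univ a)

lemma integrableOn_N (he : e ∈ K.elements) (a : Fin (p + 1)) :
    IntegrableOn (K.N (K.globalIndex e a)) (K.elemDomain e) := by
  refine Measure.integrableOn_of_bounded (M := 1) (by simp [elemDomain])
    (measurable_N _).aestronglyMeasurable ?_
  refine (ae_restrict_iff' measurableSet_Ioo).2 (.of_forall fun x hx => ?_)
  rw [Real.norm_of_nonneg (N_nonneg (globalIndex_lt he a) x)]
  exact N_le_one he hx a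

lemma integral_bernsteinB_mul_comp_elemMap (he : e ∈ K.elements) (f : ℝ → ℝ) (i : Fin (p + 1)) :
    ∫ ξ in (-1 : ℝ)..1, bernsteinB p i ξ * f (K.elemMap e ξ) =
      2 / K.meshSize e * ∫ x in K.elemDomain e, bernsteinB p i (K.elemCoord e x) * f x := by
  have hpos := meshSize_pos he
  have h := intervalIntegral.integral_comp_add_mul (a := -1) (b := 1)
    (fun x => bernsteinB p i (K.elemCoord e x) * f x) (c := K.meshSize e / 2) (by positivity)
    ((K.σ e + K.σ (e + 1)) / 2)
  have e1 : (K.σ e + K.σ (e + 1)) / 2 + K.meshSize e / 2 * -1 = K.σ e := by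
    simp only [meshSize]; ring
  have e2 : (K.σ e + K.σ (e + 1)) / 2 + K.meshSize e / 2 * 1 = K.σ (e + 1) := by
    simp only [meshSize]; ring
  rw [e1, e2, intervalIntegral.integral_of_le (σ_lt_of_mem_elements he).le,
    integral_Ioc_eq_integral_Ioo, smul_eq_mul, inv_div] at h
  rw [elemDomain, ← h]
  refine intervalIntegral.integral_congr fun ξ _ => ?_
  change _ = bernsteinB p i (K.elemCoord e (K.elemMap e ξ)) * f (K.elemMap e ξ)
  rw [elemCoord_elemMap he]

lemma bernsteinCoeff_eq (he : e ∈ K.elements) (f : ℝ → ℝ) :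
    K.bernsteinCoeff e f = (gramian p)⁻¹.mulVec fun i =>
      2 / K.meshSize e * ∫ x in K.elemDomain e, bernsteinB p i (K.elemCoord e x) * f x := by
  rw [bernsteinCoeff]
  congr 1
  exact funext fun i => integral_bernsteinB_mul_comp_elemMap he f i

lemma continuous_elemCoord : Continuous (K.elemCoord e) := by
  unfold elemCoord
  fun_prop

lemma integrableOn_bernsteinB_mul {f : ℝ → ℝ} (hf : IntegrableOn f (K.elemDomain e))
    (i : Fin (p + 1)) :
    IntegrableOn (fun x => bernsteinB p i (K.elemCoord e x) * f x) (K.elemDomain e) := by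
  have hc : Continuous fun x => bernsteinB p i (K.elemCoord e x) :=
    (continuous_bernsteinB p i).comp continuous_elemCoord
  have hf' : IntegrableOn f (Set.Icc (K.σ e) (K.σ (e + 1))) :=
    (integrableOn_Icc_iff_integrableOn_Ioo).2 hf
  exact (hf'.continuousOn_mul hc.continuousOn isCompact_Icc).mono_set Set.Ioo_subset_Icc_self

lemma bernsteinCoeff_congr_ae (he : e ∈ K.elements) {f g : ℝ → ℝ}
    (h : f =ᵐ[volume.restrict (K.elemDomain e)] g) :
    K.bernsteinCoeff e f = K.bernsteinCoeff e g := by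
  simp only [bernsteinCoeff_eq he]
  congr 1
  funext i
  congr 1
  refine integral_congr_ae ?_
  filter_upwards [h] with x hx
  rw [hx]

lemma bernsteinCoeff_add (he : e ∈ K.elements) {f g : ℝ → ℝ}
    (hf : IntegrableOn f (K.elemDomain e)) (hg : IntegrableOn g (K.elemDomain e)) :
    K.bernsteinCoeff e (fun x => f x + g x) = K.bernsteinCoeff e f + K.bernsteinCoeff e g := by
  simp only [bernsteinCoeff_eq he, mul_add]
  rw [← Matrix.mulVec_add]
  congr 1
  funext i
  rw [integral_add (integrableOn_bernsteinB_mul hf i) (integrableOn_bernsteinB_mul hg i), mul_add]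
  rfl

lemma bernsteinCoeff_sum (he : e ∈ K.elements) {ι : Type*} [Fintype ι] (c : ι → ℝ)
    {f : ι → ℝ → ℝ} (hf : ∀ a, IntegrableOn (f a) (K.elemDomain e)) :
    K.bernsteinCoeff e (fun x => ∑ a, c a * f a x) = ∑ a, c a • K.bernsteinCoeff e (f a) := by
  simp only [bernsteinCoeff_eq he, Finset.mul_sum]
  simp only [← Matrix.mulVec_smul]
  rw [← Matrix.mulVec_sum]
  congr 1
  funext i
  have e1 : ∀ x a, bernsteinB p i (K.elemCoord e x) * (c a * f a x) =
      c a * (bernsteinB p i (K.elemCoord e x) * f a x) := fun x a => by ring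
  simp only [e1]
  rw [integral_finsetSum _ fun a _ => (integrableOn_bernsteinB_mul (hf a) i).const_mul _,
    Finset.mul_sum, Finset.sum_apply]
  refine Finset.sum_congr rfl fun a _ => ?_
  rw [integral_const_mul, Pi.smul_apply, smul_eq_mul]
  ring

lemma bernsteinCoeff_eq_of_eq_sum {f : ℝ → ℝ} {c : Fin (p + 1) → ℝ}
    (h : ∀ ξ ∈ Set.Ioo (-1 : ℝ) 1, f (K.elemMap e ξ) = ∑ j, c j * bernsteinB p j ξ) :
    K.bernsteinCoeff e f = c := by
  have hm : (fun i => ∫ ξ in (-1 : ℝ)..1, bernsteinB p i ξ * f (K.elemMap e ξ)) =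
      (gramian p).mulVec c := by
    funext i
    rw [gramian_mulVec]
    refine intervalIntegral.integral_congr_uIoo fun ξ hξ => ?_
    rw [Set.uIoo_of_le (by norm_num)] at hξ
    simp only [h ξ hξ]
  rw [bernsteinCoeff, hm, Matrix.mulVec_mulVec, Matrix.nonsing_inv_mul _ (isUnit_det_gramian p),
    Matrix.one_mulVec]

/-- The matrix expressing the Bernstein basis on an element through the B-splines: its entries
are polar forms of Bernstein polynomials at the knots in the coordinate of the element. It is
the inverse of the extraction operator. -/
noncomputable def bernsteinToSpline (K : KnotVector p n) (e : ℕ) :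
    Matrix (Fin (p + 1)) (Fin (p + 1)) ℝ :=
  Matrix.of fun i a => polarForm p (bernsteinBPoly p i)
    fun j => K.elemCoord e (K.σ (K.globalIndex e a + j + 1))

lemma bernsteinB_eq_sum (he : e ∈ K.elements) {ξ : ℝ} (hξ : ξ ∈ Set.Ioo (-1 : ℝ) 1)
    (i : Fin (p + 1)) : bernsteinB p i ξ =
      ∑ a, K.bernsteinToSpline e i a * K.N (K.globalIndex e a) (K.elemMap e ξ) := by
  rw [← eval_bernsteinBPoly, eval_eq_sum_polarForm (fun η => marsden_elemMap he hξ η)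
    (natDegree_bernsteinBPoly_le p i)]
  exact Finset.sum_congr rfl fun a _ => mul_comm _ _

lemma bernsteinToSpline_mul_extraction (he : e ∈ K.elements) :
    K.bernsteinToSpline e * K.extraction e = 1 := by
  ext i j
  have h1 : K.bernsteinCoeff e
      (fun x => ∑ a, K.bernsteinToSpline e i a * K.N (K.globalIndex e a) x) = Pi.single i 1 :=
    bernsteinCoeff_eq_of_eq_sum fun ξ hξ => by
      rw [← bernsteinB_eq_sum he hξ]
      simp [Pi.single_apply]
  rw [bernsteinCoeff_sum he _ fun a => integrableOn_N he a] at h1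
  have h2 := congrFun h1 j
  rw [Finset.sum_apply] at h2
  rw [Matrix.mul_apply, Matrix.one_apply]
  simpa [extraction, Pi.single_apply, eq_comm] using h2

lemma localCoeff_eq (he : e ∈ K.elements) (f : ℝ → ℝ) :
    K.localCoeff e f = (K.bernsteinToSpline e).transpose.mulVec (K.bernsteinCoeff e f) := by
  rw [localCoeff, reconstruction, Matrix.inv_eq_left_inv (bernsteinToSpline_mul_extraction he)]

lemma N_elemMap_eq_sum (he : e ∈ K.elements) {ξ : ℝ} (hξ : ξ ∈ Set.Ioo (-1 : ℝ) 1)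
    (a : Fin (p + 1)) : K.N (K.globalIndex e a) (K.elemMap e ξ) =
      ∑ i, K.extraction e a i * bernsteinB p i ξ := by
  have hCM : K.extraction e * K.bernsteinToSpline e = 1 :=
    mul_eq_one_comm.1 (bernsteinToSpline_mul_extraction he)
  have h : (fun i => bernsteinB p i ξ) = (K.bernsteinToSpline e).mulVec
      fun a => K.N (K.globalIndex e a) (K.elemMap e ξ) :=
    funext fun i => bernsteinB_eq_sum he hξ i
  change _ = (K.extraction e).mulVec (fun i => bernsteinB p i ξ) a
  rw [h, Matrix.mulVec_mulVec, hCM, Matrix.one_mulVec]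

/-- The local coefficients reproduce splines. -/
lemma localCoeff_eq_of_eq_sum (he : e ∈ K.elements) {f : ℝ → ℝ} {c : Fin (p + 1) → ℝ}
    (h : ∀ x ∈ K.elemDomain e, f x = ∑ a, c a * K.N (K.globalIndex e a) x) :
    K.localCoeff e f = c := by
  have hCM : K.extraction e * K.bernsteinToSpline e = 1 :=
    mul_eq_one_comm.1 (bernsteinToSpline_mul_extraction he)
  have hβ : K.bernsteinCoeff e f = (K.extraction e).transpose.mulVec c := by
    refine bernsteinCoeff_eq_of_eq_sum fun ξ hξ => ?_
    rw [h _ (elemMap_mem he hξ)]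
    simp only [N_elemMap_eq_sum he hξ, Matrix.mulVec, dotProduct, Matrix.transpose_apply,
      Finset.mul_sum, Finset.sum_mul]
    rw [Finset.sum_comm]
    exact Finset.sum_congr rfl fun i _ => Finset.sum_congr rfl fun a _ => by ring
  rw [localCoeff_eq he, hβ, Matrix.mulVec_mulVec, ← Matrix.transpose_mul, hCM,
    Matrix.transpose_one, Matrix.one_mulVec]

lemma localCoeff_congr_ae (he : e ∈ K.elements) {f g : ℝ → ℝ}
    (h : f =ᵐ[volume.restrict (K.elemDomain e)] g) : K.localCoeff e f = K.localCoeff e g := by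
  rw [localCoeff, localCoeff, bernsteinCoeff_congr_ae he h]

lemma localCoeff_add (he : e ∈ K.elements) {f g : ℝ → ℝ}
    (hf : IntegrableOn f (K.elemDomain e)) (hg : IntegrableOn g (K.elemDomain e)) :
    K.localCoeff e (fun x => f x + g x) = K.localCoeff e f + K.localCoeff e g := by
  rw [localCoeff, bernsteinCoeff_add he hf hg, Matrix.mulVec_add]
  rfl

/-! ### Stability of the local coefficients -/

lemma exists_abs_bernsteinCoeff_le (p : ℕ) : ∃ D : ℝ, 0 ≤ D ∧
    ∀ {n : ℕ} {K : KnotVector p n} {e : ℕ}, e ∈ K.elements → ∀ {f : ℝ → ℝ},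
      IntegrableOn f (K.elemDomain e) → ∀ i,
        |K.bernsteinCoeff e f i| ≤ D / K.meshSize e * ∫ x in K.elemDomain e, |f x| := by
  obtain ⟨B, hB0, hB⟩ := exists_abs_iteratedDeriv_bernsteinB_le p 0
  simp only [iteratedDeriv_zero] at hB
  refine ⟨(∑ i, ∑ j, |(gramian p)⁻¹ i j|) * (2 * B), by positivity, fun {n K e} he {f} hf i => ?_⟩
  have hpos := meshSize_pos he
  have hmom : ∀ j, |2 / K.meshSize e * ∫ x in K.elemDomain e,
      bernsteinB p j (K.elemCoord e x) * f x| ≤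
      2 * B / K.meshSize e * ∫ x in K.elemDomain e, |f x| := by
    intro j
    have h1 : |∫ x in K.elemDomain e, bernsteinB p j (K.elemCoord e x) * f x| ≤
        B * ∫ x in K.elemDomain e, |f x| := by
      refine abs_integral_le_integral_abs.trans ?_
      rw [← integral_const_mul]
      refine setIntegral_mono_on (integrableOn_bernsteinB_mul hf j).abs (hf.abs.const_mul B)
        measurableSet_Ioo fun x hx => ?_
      rw [abs_mul]
      exact mul_le_mul_of_nonneg_right (hB j _ (elemCoord_mem he hx)) (abs_nonneg _)
    rw [abs_mul, abs_of_pos (by positivity : 0 < 2 / K.meshSize e)]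
    calc 2 / K.meshSize e * _ ≤ 2 / K.meshSize e * (B * ∫ x in K.elemDomain e, |f x|) := by
          gcongr
      _ = _ := by ring
  have hI : 0 ≤ ∫ x in K.elemDomain e, |f x| := integral_nonneg fun x => abs_nonneg _
  simp only [bernsteinCoeff_eq he, Matrix.mulVec, dotProduct]
  calc |∑ j, (gramian p)⁻¹ i j * _|
      ≤ ∑ j, |(gramian p)⁻¹ i j| * (2 * B / K.meshSize e * ∫ x in K.elemDomain e, |f x|) := by
        refine (Finset.abs_sum_le_sum_abs _ _).trans (Finset.sum_le_sum fun j _ => ?_)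
        rw [abs_mul]
        exact mul_le_mul_of_nonneg_left (hmom j) (abs_nonneg _)
    _ = (∑ j, |(gramian p)⁻¹ i j|) * (2 * B / K.meshSize e * ∫ x in K.elemDomain e, |f x|) := by
        rw [Finset.sum_mul]
    _ ≤ (∑ i, ∑ j, |(gramian p)⁻¹ i j|) *
        (2 * B / K.meshSize e * ∫ x in K.elemDomain e, |f x|) := by
        refine mul_le_mul_of_nonneg_right ?_ (by positivity)
        exact Finset.single_le_sum (f := fun i => ∑ j, |(gramian p)⁻¹ i j|)
          (fun i _ => Finset.sum_nonneg fun j _ => abs_nonneg _) (Finset.mem_univ i)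
    _ = _ := by ring

lemma exists_abs_extraction_le (p : ℕ) : ∃ D : ℝ, 0 ≤ D ∧
    ∀ {n : ℕ} {K : KnotVector p n} {e : ℕ}, e ∈ K.elements → ∀ a i,
      |K.extraction e a i| ≤ D := by
  obtain ⟨D, hD0, hD⟩ := exists_abs_bernsteinCoeff_le p
  refine ⟨D, hD0, fun {n K e} he a i => (hD he (integrableOn_N he a) i).trans ?_⟩
  have hpos := meshSize_pos he
  have h1 : ∫ x in K.elemDomain e, |K.N (K.globalIndex e a) x| ≤ K.meshSize e := by
    calc _ ≤ ∫ x in K.elemDomain e, (1 : ℝ) := by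
          refine setIntegral_mono_on (integrableOn_N he a).abs (by simp [elemDomain])
            measurableSet_Ioo fun x hx => ?_
          rw [abs_of_nonneg (N_nonneg (globalIndex_lt he a) x)]
          exact N_le_one he hx a
      _ = K.meshSize e := by
          simp [elemDomain, meshSize, (σ_lt_of_mem_elements he).le]
  calc D / K.meshSize e * _ ≤ D / K.meshSize e * K.meshSize e := by gcongr
    _ = D := by field_simp

lemma ShapeRegular.abs_elemCoord_σ_le {θ : ℝ} (hK : K.ShapeRegular θ) (hθ : 1 ≤ θ)
    (he : e ∈ K.elements) (a : Fin (p + 1)) {j : ℕ} (hj : j < p) :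
    |K.elemCoord e (K.σ (K.globalIndex e a + j + 1))| ≤ 2 * ((2 * p + 1) * θ ^ p) := by
  have hpos := meshSize_pos he
  have hpe := le_of_mem_elements he
  have hen := lt_of_mem_elements he
  have ha := a.2
  have hlen := hK.σ_sub_σ_le hθ he
  have h1 : K.σ (e - p) ≤ K.σ (K.globalIndex e a + j + 1) :=
    K.le_σ (by simp only [globalIndex]; omega) (by simp only [globalIndex]; omega)
  have h2 : K.σ (K.globalIndex e a + j + 1) ≤ K.σ (e + p + 1) :=
    K.le_σ (by simp only [globalIndex]; omega) (by omega)
  have h3 : K.σ (e - p) ≤ K.σ e := K.le_σ (by omega) (by omega)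
  have h4 : K.σ (e + 1) ≤ K.σ (e + p + 1) := K.le_σ (by omega) (by omega)
  have h5 := σ_lt_of_mem_elements he
  rw [elemCoord, abs_mul, abs_inv, abs_of_pos (by positivity : 0 < K.meshSize e / 2),
    inv_mul_le_iff₀ (by positivity), abs_le]
  constructor <;> linarith

/-- The local coefficients are stable, uniformly over shape regular meshes: the knots that enter
the inverse of the extraction operator are bounded in the coordinate of the element. -/
theorem exists_abs_localCoeff_le (p : ℕ) {θ : ℝ} (hθ : 1 ≤ θ) : ∃ D : ℝ, 0 ≤ D ∧
    ∀ {n : ℕ} {K : KnotVector p n}, K.ShapeRegular θ → ∀ {e : ℕ}, e ∈ K.elements →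
      ∀ {f : ℝ → ℝ}, IntegrableOn f (K.elemDomain e) → ∀ a,
        |K.localCoeff e f a| ≤ D / K.meshSize e * ∫ x in K.elemDomain e, |f x| := by
  obtain ⟨D, hD0, hD⟩ := exists_abs_bernsteinCoeff_le p
  set R : ℝ := 2 * ((2 * p + 1) * θ ^ p)
  have hR0 : 0 ≤ R := by positivity
  set M : Fin (p + 1) → ℝ := fun i =>
    ∑ j ∈ Finset.range (p + 1), |(bernsteinBPoly p i).coeff j| * (1 + R) ^ p
  refine ⟨(∑ i, M i) * D, by positivity, fun {n K} hK {e} he {f} hf a => ?_⟩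
  have hpos := meshSize_pos he
  have hI : 0 ≤ ∫ x in K.elemDomain e, |f x| := integral_nonneg fun x => abs_nonneg _
  rw [localCoeff_eq he]
  simp only [Matrix.mulVec, dotProduct, Matrix.transpose_apply]
  calc |∑ i, K.bernsteinToSpline e i a * K.bernsteinCoeff e f i|
      ≤ ∑ i, M i * (D / K.meshSize e * ∫ x in K.elemDomain e, |f x|) := by
        refine (Finset.abs_sum_le_sum_abs _ _).trans (Finset.sum_le_sum fun i _ => ?_)
        rw [abs_mul]
        exact mul_le_mul (abs_polarForm_le _ hR0 fun j hj => hK.abs_elemCoord_σ_le hθ he a hj)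
          (hD he hf i) (abs_nonneg _) (by positivity)
    _ = _ := by rw [← Finset.sum_mul]; ring

instance isFiniteMeasure_restrict_elemDomain :
    IsFiniteMeasure (volume.restrict (K.elemDomain e)) :=
  inferInstanceAs (IsFiniteMeasure (volume.restrict (Set.Ioo _ _)))

/-! ### The coefficients of the Bézier projection -/

/-- The coefficient of `N_A` in the Bézier projection. -/
noncomputable def projCoeff (K : KnotVector p n) (A : ℕ) (f : ℝ → ℝ) : ℝ :=
  ∑ e ∈ K.supportElements A, K.weight A e * K.coeffOnElement e A f

lemma coeffOnElement_globalIndex (f : ℝ → ℝ) (a : Fin (p + 1)) :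
    K.coeffOnElement e (K.globalIndex e a) f = K.localCoeff e f a := by
  rw [coeffOnElement, Finset.sum_eq_single a (fun b _ hb => if_neg fun h =>
    hb (globalIndex_injective h)) (by simp), if_pos rfl]

lemma bezierProj_eq (he : e ∈ K.elements) (f : ℝ → ℝ) {x : ℝ} (hx : x ∈ K.elemDomain e) :
    K.bezierProj f x = ∑ a : Fin (p + 1),
      K.projCoeff (K.globalIndex e a) f * K.N (K.globalIndex e a) x :=
  sum_range_N_eq_sum_globalIndex he (lt_of_mem_elements he) le_rfl (fun A => K.projCoeff A f) hx

lemma integral_N_nonneg (hA : A < n) (e : ℕ) : 0 ≤ ∫ s in K.elemDomain e, K.N A s :=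
  integral_nonneg fun s => N_nonneg hA s

lemma integral_N_pos (hA : A < n) (he : e ∈ K.supportElements A) :
    0 < ∫ s in K.elemDomain e, K.N A s := by
  obtain ⟨he', h1, h2⟩ := (mem_supportElements_iff hA).1 he
  obtain ⟨a, rfl⟩ := exists_globalIndex_eq hA he
  have hlt := σ_lt_of_mem_elements he'
  have hen := lt_of_mem_elements he'
  have hint := integrableOn_N he' a
  rw [elemDomain, ← integral_Ioc_eq_integral_Ioo, ← intervalIntegral.integral_of_le hlt.le]
  refine intervalIntegral.intervalIntegral_pos_of_pos_on
    ((intervalIntegrable_iff_integrableOn_Ioo_of_le hlt.le).2 hint) (fun x hx => ?_) hlt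
  refine N_pos hA ⟨(K.le_σ h1 (by omega)).trans_lt hx.1, hx.2.trans_le ?_⟩
  exact K.le_σ (by omega) (by omega)

lemma weight_nonneg (hA : A < n) (e : ℕ) : 0 ≤ K.weight A e :=
  div_nonneg (integral_N_nonneg hA e) (Finset.sum_nonneg fun e' _ => integral_N_nonneg hA e')

lemma sum_weight (hA : A < n) (he : e ∈ K.supportElements A) :
    ∑ e' ∈ K.supportElements A, K.weight A e' = 1 := by
  have hpos : 0 < ∑ e' ∈ K.supportElements A, ∫ s in K.elemDomain e', K.N A s :=
    Finset.sum_pos (fun e' he' => integral_N_pos hA he') ⟨e, he⟩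
  simp only [weight]
  rw [← Finset.sum_div, div_self hpos.ne']

/-- The Bézier projection reproduces polynomials, in terms of its coefficients. -/
lemma projCoeff_polynomial_add (he : e ∈ K.elements) (a : Fin (p + 1)) {q : Polynomial ℝ}
    (hq : q.natDegree ≤ p) {f F : ℝ → ℝ} (hF : IntegrableOn F (K.supportExtension e))
    (hf : f =ᵐ[volume.restrict (K.supportExtension e)] fun x => q.eval x + F x) :
    K.projCoeff (K.globalIndex e a) f =
      polarForm p q (fun i => K.σ (K.globalIndex e a + i + 1)) +
        K.projCoeff (K.globalIndex e a) F := by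
  set A := K.globalIndex e a
  have hAn : A < n := globalIndex_lt he a
  have heA : e ∈ K.supportElements A := mem_supportElements_globalIndex he a
  have hloc : ∀ e' ∈ K.supportElements A, K.coeffOnElement e' A f =
      polarForm p q (fun i => K.σ (A + i + 1)) + K.coeffOnElement e' A F := by
    intro e' he'
    have hsub := elemDomain_subset_supportExtension he hAn heA he'
    have he'' := ((mem_supportElements_iff hAn).1 he').1
    obtain ⟨a', ha'⟩ := exists_globalIndex_eq hAn he'
    have hqi : IntegrableOn (fun x => q.eval x) (K.elemDomain e') :=
      (q.continuous.integrableOn_Icc (a := K.σ e') (b := K.σ (e' + 1))).mono_set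
        Set.Ioo_subset_Icc_self
    have hqc := localCoeff_eq_of_eq_sum he'' (f := fun x => q.eval x)
      (c := fun a => polarForm p q (fun i => K.σ (K.globalIndex e' a + i + 1)))
      fun x hx => (eval_eq_sum_polarForm (fun y => marsden_local he'' hx y) hq).trans
        (Finset.sum_congr rfl fun a _ => mul_comm _ _)
    rw [← ha', coeffOnElement_globalIndex, coeffOnElement_globalIndex,
      localCoeff_congr_ae he'' (ae_restrict_of_ae_restrict_of_subset hsub hf),
      localCoeff_add he'' hqi (hF.mono_set hsub), hqc]
    rfl
  rw [projCoeff, Finset.sum_congr rfl fun e' he' => by rw [hloc e' he']]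
  simp only [mul_add, Finset.sum_add_distrib, ← Finset.sum_mul]
  rw [sum_weight hAn heA, one_mul, projCoeff]

/-- Stability of the coefficients of the Bézier projection on an element with respect to the `L²`
norm on the support extension. -/
lemma exists_sq_projCoeff_le (p : ℕ) {θ : ℝ} (hθ : 1 ≤ θ) : ∃ D : ℝ, 0 ≤ D ∧
    ∀ {n : ℕ} {K : KnotVector p n}, K.ShapeRegular θ → ∀ {e : ℕ}, e ∈ K.elements →
      ∀ {F : ℝ → ℝ}, MemLp F 2 (volume.restrict (K.supportExtension e)) → ∀ a,
        K.projCoeff (K.globalIndex e a) F ^ 2 ≤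
          D / K.meshSize e * ∫ x in K.supportExtension e, F x ^ 2 := by
  obtain ⟨D, hD0, hD⟩ := exists_abs_localCoeff_le p hθ
  refine ⟨D ^ 2 * θ ^ p, by positivity, fun {n K} hK {e} he {F} hF a => ?_⟩
  set A := K.globalIndex e a
  have hAn : A < n := globalIndex_lt he a
  have heA : e ∈ K.supportElements A := mem_supportElements_globalIndex he a
  have hpos := meshSize_pos he
  set J := ∫ x in K.supportExtension e, F x ^ 2
  have hJ0 : 0 ≤ J := integral_nonneg fun x => sq_nonneg _
  set T := D ^ 2 * θ ^ p / K.meshSize e * J with hT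
  have hT0 : 0 ≤ T := by positivity
  have hloc : ∀ e' ∈ K.supportElements A, |K.coeffOnElement e' A F| ≤ Real.sqrt T := by
    intro e' he'
    have hsub := elemDomain_subset_supportExtension he hAn heA he'
    obtain ⟨he'', h1, h2⟩ := (mem_supportElements_iff hAn).1 he'
    obtain ⟨-, h3, h4⟩ := (mem_supportElements_iff hAn).1 heA
    obtain ⟨a', ha'⟩ := exists_globalIndex_eq hAn he'
    have hpos' := meshSize_pos he''
    have hF' : MemLp F 2 (volume.restrict (K.elemDomain e')) :=
      hF.mono_measure (Measure.restrict_mono hsub le_rfl)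
    have hb := hD hK he'' (f := F) (hF'.integrable one_le_two) a'
    have hcs := sq_setIntegral_abs_le (σ_lt_of_mem_elements he'') hF'
    have hmono : ∫ x in K.elemDomain e', F x ^ 2 ≤ J :=
      setIntegral_mono_set hF.integrable_sq (.of_forall fun x => sq_nonneg _) hsub.eventuallyLE
    have hsize : K.meshSize e ≤ θ ^ p * K.meshSize e' :=
      hK.meshSize_le hθ he he'' (by omega) (by omega)
    refine Real.abs_le_sqrt ?_
    rw [← ha', coeffOnElement_globalIndex, ← sq_abs]
    have hcs' : (∫ x in K.elemDomain e', |F x|) ^ 2 ≤ K.meshSize e' * J :=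
      hcs.trans (mul_le_mul_of_nonneg_left hmono hpos'.le)
    calc |K.localCoeff e' F a'| ^ 2
        ≤ (D / K.meshSize e' * ∫ x in K.elemDomain e', |F x|) ^ 2 := by gcongr
      _ = (D / K.meshSize e') ^ 2 * (∫ x in K.elemDomain e', |F x|) ^ 2 := by ring
      _ ≤ (D / K.meshSize e') ^ 2 * (K.meshSize e' * J) := by gcongr
      _ = D ^ 2 * J * (1 / K.meshSize e') := by field_simp
      _ ≤ D ^ 2 * J * (θ ^ p / K.meshSize e) := by
        refine mul_le_mul_of_nonneg_left ?_ (by positivity)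
        rw [div_le_div_iff₀ hpos' hpos]
        linarith
      _ = T := by rw [hT]; ring
  have habs : |K.projCoeff A F| ≤ Real.sqrt T := by
    calc |K.projCoeff A F| ≤ ∑ e' ∈ K.supportElements A, K.weight A e' * Real.sqrt T := by
          refine (Finset.abs_sum_le_sum_abs _ _).trans (Finset.sum_le_sum fun e' he' => ?_)
          rw [abs_mul, abs_of_nonneg (weight_nonneg hAn e')]
          exact mul_le_mul_of_nonneg_left (hloc e' he') (weight_nonneg hAn e')
      _ = Real.sqrt T := by rw [← Finset.sum_mul, sum_weight hAn heA, one_mul]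
  rw [← sq_abs, ← Real.sq_sqrt hT0]
  gcongr

/-! ### Derivatives of splines on an element -/

/-- The polynomial with Bernstein coefficients `γ` on the element `e`, as a function on `ℝ`. -/
noncomputable def bernsteinSum (K : KnotVector p n) (e : ℕ) (γ : Fin (p + 1) → ℝ) (x : ℝ) : ℝ :=
  ∑ i, γ i * bernsteinB p i (K.elemCoord e x)

lemma contDiff_bernsteinSum (γ : Fin (p + 1) → ℝ) : ContDiff ℝ ∞ (K.bernsteinSum e γ) := by
  unfold bernsteinSum elemCoord
  refine ContDiff.sum fun i _ => contDiff_const.mul ((contDiff_bernsteinB p i).comp ?_)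
  fun_prop

lemma sum_N_eq_bernsteinSum (he : e ∈ K.elements) (c : Fin (p + 1) → ℝ) {x : ℝ}
    (hx : x ∈ K.elemDomain e) : ∑ a, c a * K.N (K.globalIndex e a) x =
      K.bernsteinSum e (fun i => ∑ a, c a * K.extraction e a i) x := by
  have h : ∀ a, K.N (K.globalIndex e a) x =
      ∑ i, K.extraction e a i * bernsteinB p i (K.elemCoord e x) := fun a => by
    rw [← N_elemMap_eq_sum he (elemCoord_mem he hx), elemMap_elemCoord he]
  simp only [h, bernsteinSum, Finset.mul_sum, Finset.sum_mul]
  rw [Finset.sum_comm]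
  exact Finset.sum_congr rfl fun i _ => Finset.sum_congr rfl fun a _ => by ring

lemma iteratedDeriv_bernsteinSum (γ : Fin (p + 1) → ℝ) (j : ℕ) (x : ℝ) :
    iteratedDeriv j (K.bernsteinSum e γ) x =
      ∑ i, γ i * ((2 / K.meshSize e) ^ j * iteratedDeriv j (bernsteinB p i) (K.elemCoord e x)) := by
  have hb : ∀ i, ContDiff ℝ j (bernsteinB p i) := fun i =>
    (contDiff_bernsteinB p i).of_le (by exact_mod_cast le_top)
  have hc : ∀ i, ContDiff ℝ j fun x => bernsteinB p i (K.elemCoord e x) := fun i =>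
    (hb i).comp (by unfold elemCoord; fun_prop)
  have hcomp : ∀ i, iteratedDeriv j (fun x => bernsteinB p i (K.elemCoord e x)) x =
      (2 / K.meshSize e) ^ j * iteratedDeriv j (bernsteinB p i) (K.elemCoord e x) := by
    intro i
    have h1 := congrFun (iteratedDeriv_comp_const_mul (hb i) (K.meshSize e / 2)⁻¹)
      (x - (K.σ e + K.σ (e + 1)) / 2)
    have h2 := congrFun (iteratedDeriv_comp_sub_const (n := j)
      (f := fun x => bernsteinB p i ((K.meshSize e / 2)⁻¹ * x)) (s := (K.σ e + K.σ (e + 1)) / 2)) x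
    rw [inv_div] at h1 h2
    simp only [elemCoord, inv_div]
    exact h2.trans h1
  change iteratedDeriv j (fun x => ∑ i, γ i * bernsteinB p i (K.elemCoord e x)) x = _
  rw [iteratedDeriv_fun_sum fun i _ => (contDiff_const.mul (hc i)).contDiffAt]
  refine Finset.sum_congr rfl fun i _ => ?_
  rw [iteratedDeriv_const_mul_field, hcomp]

/-- Inverse inequality for the part of a spline on one element. -/
lemma exists_abs_iteratedDeriv_bernsteinSum_le (p j : ℕ) : ∃ D : ℝ, 0 ≤ D ∧
    ∀ {n : ℕ} {K : KnotVector p n} {e : ℕ}, e ∈ K.elements →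
      ∀ {c : Fin (p + 1) → ℝ} {T : ℝ}, (∀ a, |c a| ≤ T) → ∀ x ∈ K.elemDomain e,
        |iteratedDeriv j (K.bernsteinSum e fun i => ∑ a, c a * K.extraction e a i) x| ≤
          D * T / K.meshSize e ^ j := by
  obtain ⟨B, hB0, hB⟩ := exists_abs_iteratedDeriv_bernsteinB_le p j
  obtain ⟨E, hE0, hE⟩ := exists_abs_extraction_le p
  refine ⟨(p + 1) * ((p + 1) * E * (2 ^ j * B)), by positivity, fun {n K e} he {c T} hc x hx => ?_⟩
  have hpos := meshSize_pos he
  have hT : 0 ≤ T := (abs_nonneg _).trans (hc 0)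
  have hγ : ∀ i, |∑ a, c a * K.extraction e a i| ≤ (p + 1) * (T * E) := fun i => by
    refine (Finset.abs_sum_le_sum_abs _ _).trans ?_
    refine (Finset.sum_le_card_nsmul _ _ (T * E) fun a _ => ?_).trans (by simp)
    rw [abs_mul]
    exact mul_le_mul (hc a) (hE he a i) (abs_nonneg _) hT
  rw [iteratedDeriv_bernsteinSum]
  refine (Finset.abs_sum_le_sum_abs _ _).trans ?_
  refine (Finset.sum_le_card_nsmul _ _ ((p + 1) * (T * E) * ((2 / K.meshSize e) ^ j * B))
    fun i _ => ?_).trans (le_of_eq ?_)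
  · rw [abs_mul, abs_mul, abs_of_nonneg (by positivity : 0 ≤ (2 / K.meshSize e) ^ j)]
    refine mul_le_mul (hγ i) ?_ (by positivity) (by positivity)
    exact mul_le_mul_of_nonneg_left (hB i _ (elemCoord_mem he hx)) (by positivity)
  · rw [div_pow]
    simp
    field_simp

/-! ### The error estimate -/

/-- The error estimate for a single derivative. -/
theorem exists_hasWeakDeriv_sub_bezierProj (p : ℕ) {j m : ℕ} (hjm : j ≤ m) (hmp : m ≤ p + 1)
    {θ : ℝ} (hθ : 1 ≤ θ) : ∃ C : ℝ, 0 ≤ C ∧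
    ∀ {n : ℕ} {K : KnotVector p n}, K.ShapeRegular θ → ∀ {e : ℕ}, e ∈ K.elements →
      ∀ {f g : ℝ → ℝ}, HasWeakDeriv m f g (K.supportExtension e) →
        MemLp g 2 (volume.restrict (K.supportExtension e)) →
        ∃ w, HasWeakDeriv j (fun s => f s - K.bezierProj f s) w (K.elemDomain e) ∧
          MemLp w 2 (volume.restrict (K.elemDomain e)) ∧
          ∫ x in K.elemDomain e, w x ^ 2 ≤
            C * (K.meshSize e ^ (m - j)) ^ 2 * ∫ x in K.supportExtension e, g x ^ 2 := by
  obtain ⟨D, hD0, hD⟩ := exists_sq_projCoeff_le p hθ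
  obtain ⟨E, hE0, hE⟩ := exists_abs_iteratedDeriv_bernsteinSum_le p j
  set Λ : ℝ := (2 * p + 1) * θ ^ p with hΛ
  have hΛ0 : 0 ≤ Λ := by positivity
  refine ⟨2 * (Λ ^ (m - j)) ^ 2 + 2 * (E ^ 2 * D * (Λ ^ m) ^ 2), by positivity,
    fun {n K} hK {e} he {f g} hfg hg => ?_⟩
  have hpos := meshSize_pos he
  have hpe := le_of_mem_elements he
  have hen := lt_of_mem_elements he
  have hsub : K.elemDomain e ⊆ K.supportExtension e :=
    elemDomain_subset_supportExtension he (globalIndex_lt he 0)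
      (mem_supportElements_globalIndex he 0) (mem_supportElements_globalIndex he 0)
  have hlen := hK.σ_sub_σ_le hθ he
  rw [← hΛ] at hlen
  have hD' := fun F => hD hK he (F := F)
  have hrep := fun a (q : Polynomial ℝ) (hq : q.natDegree ≤ p) F =>
    projCoeff_polynomial_add he a hq (f := f) (F := F)
  rw [supportExtension_eq he] at hfg hg hsub ⊢
  simp only [supportExtension_eq he] at hD' hrep
  set a := K.σ (e - p)
  set b := K.σ (e + p + 1)
  have hab : a < b := by
    have h1 : a ≤ K.σ e := K.le_σ (by omega) (by omega)
    have h2 : K.σ (e + 1) ≤ b := K.le_σ (by omega) (by omega)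
    linarith [σ_lt_of_mem_elements he]
  obtain ⟨q, hq, hfq⟩ := hfg.exists_polynomial_add_iterPrimitive hab hg
  have hqp : q.natDegree ≤ p := by
    rw [Polynomial.natDegree_le_iff_coeff_eq_zero]
    exact fun N hN => (Polynomial.degree_lt_iff_coeff_zero q m).1 hq N (by omega)
  set F := iterPrimitive a g m
  have hFm : MemLp F 2 (volume.restrict (Set.Ioo a b)) := memLp_iterPrimitive hab.le hg m
  set J := ∫ x in Set.Ioo a b, g x ^ 2
  have hJ0 : 0 ≤ J := integral_nonneg fun x => sq_nonneg _
  have hbound : ∀ i, ∫ x in Set.Ioo a b, iterPrimitive a g i x ^ 2 ≤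
      ((Λ * K.meshSize e) ^ i) ^ 2 * J := fun i =>
    (setIntegral_sq_iterPrimitive_le hab hg i).trans (by
      have : 0 ≤ b - a := by linarith
      gcongr)
  set c : Fin (p + 1) → ℝ := fun a => K.projCoeff (K.globalIndex e a) F with hc
  set S := K.bernsteinSum e (fun i => ∑ a, c a * K.extraction e a i) with hS
  have hSs : ContDiff ℝ ∞ S := contDiff_bernsteinSum _
  set T := Real.sqrt (D / K.meshSize e * (((Λ * K.meshSize e) ^ m) ^ 2 * J)) with hT
  have hcT : ∀ a, |c a| ≤ T := fun a =>
    Real.abs_le_sqrt ((hD' F hFm a).trans (by gcongr; exact hbound m))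
  -- The polynomial parts of `f` and of its projection cancel.
  have herr : (fun x => F x - S x) =ᵐ[volume.restrict (K.elemDomain e)]
      fun x => f x - K.bezierProj f x := by
    filter_upwards [ae_restrict_of_ae_restrict_of_subset hsub hfq,
      ae_restrict_mem measurableSet_Ioo] with x hx hxe
    have hpol := eval_eq_sum_polarForm (fun y => marsden_local he hxe y) hqp
    rw [bezierProj_eq he f hxe, hx, hS, ← sum_N_eq_bernsteinSum he c hxe, hpol]
    simp only [hrep _ q hqp F (hFm.integrable one_le_two) hfq, add_mul, Finset.sum_add_distrib,
      mul_comm (polarForm _ _ _), hc]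
    ring
  have hFe : MemLp F 2 (volume.restrict (K.elemDomain e)) :=
    hFm.mono_measure (Measure.restrict_mono hsub le_rfl)
  have hFj : MemLp (iterPrimitive a g (m - j)) 2 (volume.restrict (K.elemDomain e)) :=
    (memLp_iterPrimitive hab.le hg (m - j)).mono_measure (Measure.restrict_mono hsub le_rfl)
  have hFw : HasWeakDeriv j F (iterPrimitive a g (m - j)) (K.elemDomain e) := by
    have := (hasWeakDeriv_iterPrimitive hab.le (hg.intervalIntegrable_of_two hab.le)
      (m - j) j).mono hsub
    rwa [Nat.sub_add_cancel hjm] at this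
  have hSj : Continuous (iteratedDeriv j S) :=
    hSs.continuous_iteratedDeriv j (by exact_mod_cast le_top)
  have hSb : ∀ x ∈ K.elemDomain e, |iteratedDeriv j S x| ≤ E * T / K.meshSize e ^ j :=
    fun x hx => hE he hcT x hx
  have hSm : MemLp (iteratedDeriv j S) 2 (volume.restrict (K.elemDomain e)) := by
    exact MemLp.of_bound hSj.aestronglyMeasurable _
      ((ae_restrict_iff' measurableSet_Ioo).2 (.of_forall hSb))
  have hSi : IntegrableOn S (K.elemDomain e) :=
    (hSs.continuous.integrableOn_Icc (a := K.σ e) (b := K.σ (e + 1))).mono_set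
      Set.Ioo_subset_Icc_self
  have herri : IntegrableOn (fun x => f x - K.bezierProj f x) (K.elemDomain e) := by
    exact ((hFe.integrable one_le_two).sub hSi).congr herr
  refine ⟨fun x => iterPrimitive a g (m - j) x - iteratedDeriv j S x,
    (hFw.sub (.of_contDiff hSs)).congr_left isOpen_Ioo herr herri.locallyIntegrableOn,
    hFj.sub hSm, ?_⟩
  have h1 : ∫ x in K.elemDomain e, iterPrimitive a g (m - j) x ^ 2 ≤
      ((Λ * K.meshSize e) ^ (m - j)) ^ 2 * J :=
    (setIntegral_mono_set (memLp_iterPrimitive hab.le hg (m - j)).integrable_sq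
      (.of_forall fun x => sq_nonneg _) hsub.eventuallyLE).trans (hbound _)
  have h2 : ∫ x in K.elemDomain e, iteratedDeriv j S x ^ 2 ≤
      E ^ 2 * D * (Λ ^ m) ^ 2 * (K.meshSize e ^ (m - j)) ^ 2 * J := by
    calc ∫ x in K.elemDomain e, iteratedDeriv j S x ^ 2
        ≤ ∫ x in K.elemDomain e, (E * T / K.meshSize e ^ j) ^ 2 := by
          refine setIntegral_mono_on hSm.integrable_sq (by simp [elemDomain]) measurableSet_Ioo
            fun x hx => ?_
          rw [← sq_abs]
          exact pow_le_pow_left₀ (abs_nonneg _) (hSb x hx) 2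
      _ = K.meshSize e * (E * T / K.meshSize e ^ j) ^ 2 := by
          simp [elemDomain, meshSize, (σ_lt_of_mem_elements he).le]
      _ = K.meshSize e * (E / K.meshSize e ^ j) ^ 2 * T ^ 2 := by ring
      _ = E ^ 2 * D * (Λ ^ m) ^ 2 * (K.meshSize e ^ (m - j)) ^ 2 * J := by
          rw [hT, Real.sq_sqrt (by positivity)]
          have h3 : K.meshSize e ^ m = K.meshSize e ^ (m - j) * K.meshSize e ^ j := by
            rw [← pow_add, Nat.sub_add_cancel hjm]
          rw [mul_pow Λ, h3]
          field_simp
  calc ∫ x in K.elemDomain e, (iterPrimitive a g (m - j) x - iteratedDeriv j S x) ^ 2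
      ≤ ∫ x in K.elemDomain e,
          (2 * iterPrimitive a g (m - j) x ^ 2 + 2 * iteratedDeriv j S x ^ 2) := by
        refine setIntegral_mono_on (hFj.sub hSm).integrable_sq
          ((hFj.integrable_sq.const_mul 2).add (hSm.integrable_sq.const_mul 2))
          measurableSet_Ioo fun x _ => ?_
        nlinarith [sq_nonneg (iterPrimitive a g (m - j) x + iteratedDeriv j S x)]
    _ = 2 * (∫ x in K.elemDomain e, iterPrimitive a g (m - j) x ^ 2) +
          2 * ∫ x in K.elemDomain e, iteratedDeriv j S x ^ 2 := by
        rw [integral_add (hFj.integrable_sq.const_mul 2) (hSm.integrable_sq.const_mul 2),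
          integral_const_mul, integral_const_mul]
    _ ≤ 2 * (((Λ * K.meshSize e) ^ (m - j)) ^ 2 * J) +
          2 * (E ^ 2 * D * (Λ ^ m) ^ 2 * (K.meshSize e ^ (m - j)) ^ 2 * J) := by gcongr
    _ = _ := by rw [mul_pow Λ]; ring

lemma ShapeRegular.mono {θ θ' : ℝ} (hK : K.ShapeRegular θ) (h : θ ≤ θ') : K.ShapeRegular θ' := by
  intro e he e' he' hee'
  have h1 := meshSize_pos he
  have h2 := meshSize_pos he'
  obtain ⟨h3, h4⟩ := hK e he e' he' hee'
  exact ⟨h3.trans (by gcongr), h4.trans (by gcongr)⟩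

end KnotVector

end BezierProjection

open BezierProjection KnotVector in
theorem mainTheorem1 (p k l : ℕ) (α : ℤ) (hkl : k ≤ l) (hlp : l ≤ p + 1)
    (hlα : (l : ℤ) ≤ α + 1) (θ : ℝ) :
    ∃ C : ℝ, 0 < C ∧
      ∀ (n : ℕ) (K : BezierProjection.KnotVector p n),
        K.IsContinuity α → K.ShapeRegular θ →
        ∀ e ∈ K.elements, ∀ f : ℝ → ℝ,
          BezierProjection.MemH l f (K.supportExtension e) →
            BezierProjection.MemH k (fun s => f s - K.bezierProj f s) (K.elemDomain e) ∧
            BezierProjection.normH k (fun s => f s - K.bezierProj f s) (K.elemDomain e) ≤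
              C * K.meshSize e ^ (l - k) *
                BezierProjection.normH l f (K.supportExtension e) := by
  -- The derivative of order `j` of the error is estimated by that of order `l - k + j` of `f`:
  -- the power of the mesh size is then `l - k` for every `j`, on coarse meshes as well.
  have key := fun j : Fin (k + 1) => exists_hasWeakDeriv_sub_bezierProj p
    (show (j : ℕ) ≤ l - k + j by omega) (show l - k + j ≤ p + 1 by omega) (le_max_right θ 1)
  choose C hC0 hC using key
  have hsum0 : 0 ≤ ∑ j, C j := Finset.sum_nonneg fun j _ => hC0 j
  refine ⟨Real.sqrt (∑ j, C j) + 1, by positivity, fun n K _ hK e he f hf => ?_⟩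
  have hpos := meshSize_pos he
  have hK' := hK.mono (le_max_left θ 1)
  have hopen : IsOpen (K.supportExtension e) := isOpen_interior
  have hfd : ∀ m ≤ l, HasWeakDeriv m f (weakDeriv m f (K.supportExtension e))
      (K.supportExtension e) ∧
      MemLp (weakDeriv m f (K.supportExtension e)) 2 (volume.restrict (K.supportExtension e)) := by
    intro m hm
    obtain ⟨g, hg, hg2⟩ := hf m hm
    exact ⟨hasWeakDeriv_weakDeriv hg, hg2.ae_eq (weakDeriv_ae_eq hg hopen).symm⟩
  have hex := fun j : Fin (k + 1) => hC j hK' he (hfd (l - k + j) (by omega)).1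
    (hfd (l - k + j) (by omega)).2
  choose w hw hw2 hwb using hex
  refine ⟨fun j hj => ⟨w ⟨j, by omega⟩, hw ⟨j, by omega⟩, hw2 ⟨j, by omega⟩⟩, ?_⟩
  set X := ∑ m ∈ Finset.range (l + 1),
    ∫ x in K.supportExtension e, weakDeriv m f (K.supportExtension e) x ^ 2
  have hle : ∀ m ≤ l, ∫ x in K.supportExtension e,
      weakDeriv m f (K.supportExtension e) x ^ 2 ≤ X := fun m hm =>
    Finset.single_le_sum (f := fun m => ∫ x in K.supportExtension e,
      weakDeriv m f (K.supportExtension e) x ^ 2)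
      (fun _ _ => integral_nonneg fun _ => sq_nonneg _) (Finset.mem_range.2 (by omega))
  have hbound : ∑ j ∈ Finset.range (k + 1), ∫ x in K.elemDomain e,
      weakDeriv j (fun s => f s - K.bezierProj f s) (K.elemDomain e) x ^ 2 ≤
      (∑ j, C j) * (K.meshSize e ^ (l - k)) ^ 2 * X := by
    rw [← Fin.sum_univ_eq_sum_range (fun j => ∫ x in K.elemDomain e,
      weakDeriv j (fun s => f s - K.bezierProj f s) (K.elemDomain e) x ^ 2), Finset.sum_mul,
      Finset.sum_mul]
    refine Finset.sum_le_sum fun j _ => ?_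
    have hae : ∫ x in K.elemDomain e,
        weakDeriv j (fun s => f s - K.bezierProj f s) (K.elemDomain e) x ^ 2 =
        ∫ x in K.elemDomain e, w j x ^ 2 := by
      refine integral_congr_ae ?_
      filter_upwards [weakDeriv_ae_eq (hw j) isOpen_Ioo] with x hx
      rw [hx]
    have h1 := hwb j
    rw [show l - k + (j : ℕ) - j = l - k by omega] at h1
    rw [hae]
    refine h1.trans (mul_le_mul_of_nonneg_left (hle _ (by omega)) ?_)
    have := hC0 j
    positivity
  have hX0 : 0 ≤ X := Finset.sum_nonneg fun _ _ => integral_nonneg fun _ => sq_nonneg _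
  calc normH k (fun s => f s - K.bezierProj f s) (K.elemDomain e)
      ≤ Real.sqrt ((∑ j, C j) * (K.meshSize e ^ (l - k)) ^ 2 * X) := Real.sqrt_le_sqrt hbound
    _ = Real.sqrt (∑ j, C j) * K.meshSize e ^ (l - k) * Real.sqrt X := by
        rw [Real.sqrt_mul (by positivity), Real.sqrt_mul hsum0, Real.sqrt_sq (by positivity)]
    _ ≤ (Real.sqrt (∑ j, C j) + 1) * K.meshSize e ^ (l - k) * Real.sqrt X := by
        gcongr
        linarith
    _ = _ := rfl
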